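/- Let $m(x)=x(1-x)$ on $(0,1)$. Let $\Omega$ be the set of Radon measures $\omega$ on $(0,1)$ with values in $\{0,1,2,\dots\}\cup\{+\infty\}$ such that $\omega(m):=\int m\,d\omega<+\infty$, endowed with the weakest topology for which $\omega\mapsto\omega(m\phi)$ is continuous for every $\phi\in C_0(0,1)$ (continuous functions on $[0,1]$ vanishing at the endpoints), and let $\mathcal B(\Omega)$ be its Borel $\sigma$-algebra. Let $\mathbf P^0_x$, $x\in(0,1)$, be the law of Brownian motion $X$ on $(0,1)$ started at $x$ and absorbed at the endpoints, i.e. of $x+W$ stopped at its first exit time from $(0,1)$, where $W$ is a standard Brownian motion; let $\tau_a=\inf\{t\ge 0: X(t)=a\}$. For $\omega=\sum_k\delta_{x_k}\in\Omega$ and $t\ge0$ let $P^0_t(\omega,\cdot)$ be the law on $\Omega$ of $\sum_k\delta_{X_k(t)}(\,\cdot\cap(0,1))$, where the $X_k$ are independent with laws $\mathbf P^0_{x_k}$. For $\lambda=(\lambda_0,\lambda_1)$ with $\lambda_0,\lambda_1\ge0$ let $\mu^\lambda_t$ be the measure on $(0,1)$ $$\mu_t^\lambda(dx)=\big[\lambda_0\,\mathbf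 P^0_x(\tau_0\le t)+\lambda_1\,\mathbf P^0_x(\tau_1\le t)\big]\,dx ,$$ let $\Pi_{\mu}$ be the law of the Poisson point process on $(0,1)$ with intensity measure $\mu$, and set $$P_t(\omega,B)=\iint_{\eta_1+\eta_2\in B}\Pi_{\mu_t^\lambda}(d\eta_1)\,P_t^0(\omega,d\eta_2),\qquad t\ge0,\ \omega\in\Omega,\ B\in\mathcal B(\Omega).$$ **Lemma.** For each $\lambda\in[0,\infty)^2$ the family $P_t$, $t\ge0$, is a time-homogeneous Markov transition function on $(\Omega,\mathcal B(\Omega))$. That is: 1. $P_t(\omega,\cdot)$ is a probability measure on $(\Omega,\mathcal B(\Omega))$ for all $t\ge0$, $\omega\in\Omega$, and $P_0(\omega,\cdot)=\delta_\omega$; 2. $(t,\omega)\mapsto P_t(\omega,B)$ is measurable on $[0,\infty)\times\Omega$ for every $B\in\mathcal B(\Omega)$; 3. (Chapman–Kolmogorov) $P_{s+t}(\omega,B)=\int P_s(\omega,d\eta)\,P_t(\eta,B)$ for all $s,t\ge0$, $\omega\in\Omega$, $B\in\mathcal B(\Omega)$. -/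

import Mathlib

open MeasureTheory ProbabilityTheory
open scoped NNReal ENNReal ZeroAtInfty

namespace BrownianGas

noncomputable section

/-! ### Time-homogeneous transition functions -/

/-- A family `P t x` (`t ≥ 0`, `x ∈ E`) of measures on a measurable space `E` is a time-homogeneous
(Markov) transition function: each `P t x` is a probability measure, `P 0 x = δ_x`, the map
`(t, x) ↦ P t x B` is measurable for every measurable `B`, and the Chapman-Kolmogorov equation
holds. -/
structure IsTransitionFunction {E : Type*} [MeasurableSpace E] (P : ℝ≥0 → E → Measure E) :
    Prop where
  isProbabilityMeasure : ∀ t x, IsProbabilityMeasure (P t x)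
  zero : ∀ x, P 0 x = Measure.dirac x
  measurable : ∀ B : Set E, MeasurableSet B → Measurable fun p : ℝ≥0 × E => P p.1 p.2 B
  chapmanKolmogorov : ∀ (s t : ℝ≥0) (x : E) (B : Set E), MeasurableSet B →
    P (s + t) x B = ∫⁻ y, P t y B ∂(P s x)

/-! ### The configuration space -/

/-- The open interval `(0,1)`. -/
abbrev I01 : Type := Set.Ioo (0 : ℝ) 1

/-- The function `m(x) = x (1 - x)` on `(0,1)`. -/
def m (x : I01) : ℝ := (x : ℝ) * (1 - (x : ℝ))

lemma m_nonneg (x : I01) : 0 ≤ m x :=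
  mul_nonneg x.2.1.le (sub_nonneg.2 x.2.2.le)

/-- A measure on `(0,1)` is a tempered configuration if it is a Radon measure with values in
`{0, 1, 2, …} ∪ {+∞}` such that `ω(m) < +∞`. -/
structure IsConfiguration (ω : Measure I01) : Prop where
  radon : ∀ K : Set I01, IsCompact K → ω K < ∞
  integer_valued : ∀ A : Set I01, MeasurableSet A → ∃ n : ℕ∞, ω A = (n : ℝ≥0∞)
  tempered : ∫⁻ x, ENNReal.ofReal (m x) ∂ω < ∞

/-- The space `Ω` of tempered configurations. -/
structure Configuration where
  /-- The configuration as a measure on `(0,1)`. -/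
  toMeasure : Measure I01
  isConfiguration : IsConfiguration toMeasure

namespace Configuration

/-- The weakest topology on `Ω` for which `ω ↦ ω(m φ)` is continuous for every `φ ∈ C₀(0,1)`. -/
instance : TopologicalSpace Configuration :=
  TopologicalSpace.induced
    (fun (ω : Configuration) (φ : C₀(I01, ℝ)) => ∫ x, m x * φ x ∂ω.toMeasure)
    Pi.topologicalSpace

/-- `Ω` carries its Borel σ-algebra. -/
instance : MeasurableSpace Configuration := borel Configuration

instance : BorelSpace Configuration := ⟨rfl⟩

/-- The empty configuration. -/
instance : Zero Configuration where
  zero := ⟨0, fun _ _ => by simp, fun _ _ => ⟨0, by simp⟩, by simp⟩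

/-- The sum (superposition) of two configurations. -/
instance : Add Configuration where
  add ω η := ⟨ω.toMeasure + η.toMeasure,
    fun K hK => by
      simpa using ⟨ω.isConfiguration.radon K hK, η.isConfiguration.radon K hK⟩,
    fun A hA => by
      obtain ⟨a, ha⟩ := ω.isConfiguration.integer_valued A hA
      obtain ⟨b, hb⟩ := η.isConfiguration.integer_valued A hA
      exact ⟨a + b, by simp [ha, hb]⟩,
    by
      rw [lintegral_add_measure]
      exact ENNReal.add_lt_top.2 ⟨ω.isConfiguration.tempered, η.isConfiguration.tempered⟩⟩

open scoped Classical in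
/-- The configuration `∑ᵢ δ_{yᵢ}(· ∩ (0,1))` formed by those points of the family `y` that lie in
`(0,1)`, counted with multiplicity; by convention the empty configuration if these points do not
form a tempered configuration. -/
def ofPoints {ι : Type*} (y : ι → ℝ) : Configuration :=
  if h : IsConfiguration
      ((Measure.sum fun i => Measure.dirac (y i)).comap ((↑) : I01 → ℝ)) then ⟨_, h⟩ else 0

/-- The particles of the configuration `ω`: each position `x ∈ (0,1)` is listed `ω({x})` times,
so that `ω = ∑_{p : ω.Particle} δ_{p.1}`. -/
def Particle (ω : Configuration) : Type :=
  Σ x : I01, Fin ⌊(ω.toMeasure {x}).toReal⌋₊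

/-- The position of a particle. -/
def Particle.pos {ω : Configuration} (p : ω.Particle) : ℝ := (p.1 : ℝ)

end Configuration

/-! ### The Poisson point process -/

/-- The law `Π_μ` of the Poisson point process on `(0,1)` with finite intensity measure `μ`,
as a probability on `Ω`: the number of points is Poisson with parameter `μ(0,1)` and, given that
there are `n` of them, the points are independent with law `μ / μ(0,1)`. That is,
`Π_μ = ∑ₙ e^{-μ(0,1)} / n! · (image of μ^{⊗n} under (x₁, …, xₙ) ↦ δ_{x₁} + … + δ_{xₙ})`. -/
def poissonLaw (μ : Measure I01) [IsFiniteMeasure μ] : Measure Configuration :=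
  Measure.sum fun n : ℕ =>
    ENNReal.ofReal (Real.exp (-μ.real Set.univ) / (n.factorial : ℝ)) •
      (Measure.pi fun _ : Fin n => μ).map
        fun x => Configuration.ofPoints fun i => (x i : ℝ)

/-! ### Absorbed Brownian motion -/

section Dynamics

variable {S : Type*}

/-- The Brownian motion `x + W` absorbed at the endpoints of `(0,1)`: the path is stopped at the
first time at which it is outside `(0,1)`. -/
def absorbed (W : ℝ≥0 → S → ℝ) (x : ℝ) : ℝ≥0 → S → ℝ :=
  stoppedProcess (fun t s => x + W t s)
    (hittingAfter (fun t s => x + W t s) (Set.Ioo (0 : ℝ) 1)ᶜ 0)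

/-- The hitting time `τ_a = inf {t ≥ 0 : X(t) = a}` (with `inf ∅ = +∞`) of `a ∈ [0,1]` by the
absorbed Brownian motion `X` started at `x`. -/
def hitTime (W : ℝ≥0 → S → ℝ) (x a : ℝ) : S → WithTop ℝ≥0 :=
  hittingAfter (absorbed W x) {a} 0

variable [MeasurableSpace S]

/-- The law `P_t^0(ω, ·)` at time `t` of independent Brownian motions on `(0,1)` with absorption
at the endpoints, one started from each particle of `ω` (each driven by its own independent copy
of `W`); only the particles that are in `(0,1)` at time `t` are recorded. -/
def freeLaw (Pr : Measure S) (W : ℝ≥0 → S → ℝ) (t : ℝ≥0) (ω : Configuration) :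
    Measure Configuration :=
  (Measure.infinitePi fun _ : ω.Particle => Pr).map
    fun w => Configuration.ofPoints fun p : ω.Particle => absorbed W p.pos t (w p)

/-- The measure `μ_t^λ(dx) = [λ₀ P_x(τ₀ ≤ t) + λ₁ P_x(τ₁ ≤ t)] dx` on `(0,1)`. -/
def injection (Pr : Measure S) (W : ℝ≥0 → S → ℝ) (lam₀ lam₁ : ℝ≥0) (t : ℝ≥0) : Measure I01 :=
  ((volume : Measure ℝ).comap ((↑) : I01 → ℝ)).withDensity fun x =>
    lam₀ * Pr {s | hitTime W x 0 s ≤ (t : WithTop ℝ≥0)} +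
      lam₁ * Pr {s | hitTime W x 1 s ≤ (t : WithTop ℝ≥0)}

instance (Pr : Measure S) [IsProbabilityMeasure Pr] (W : ℝ≥0 → S → ℝ) (lam₀ lam₁ : ℝ≥0) (t : ℝ≥0) :
    IsFiniteMeasure (injection Pr W lam₀ lam₁ t) := by
  refine isFiniteMeasure_withDensity (ne_top_of_le_ne_top ?_
    (lintegral_mono (g := fun _ => (lam₀ + lam₁ : ℝ≥0∞)) fun x => ?_))
  · have h : (volume : Measure ℝ).comap ((↑) : I01 → ℝ) Set.univ ≠ ∞ := by
      rw [comap_subtype_coe_apply measurableSet_Ioo, Set.image_univ, Subtype.range_coe]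
      exact measure_Ioo_lt_top.ne
    simpa using ENNReal.mul_ne_top (by simp) h
  · exact add_le_add (mul_le_of_le_one_right' prob_le_one)
      (mul_le_of_le_one_right' prob_le_one)

/-- The law `P_t(ω, ·)` of the boundary driven Brownian gas at time `t` started from `ω`, i.e.
`P_t(ω, B) = ∬_{η₁ + η₂ ∈ B} Π_{μ_t^λ}(dη₁) P_t^0(ω, dη₂)`. -/
def gasLaw (Pr : Measure S) [IsProbabilityMeasure Pr] (W : ℝ≥0 → S → ℝ) (lam₀ lam₁ : ℝ≥0)
    (t : ℝ≥0) (ω : Configuration) : Measure Configuration :=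
  ((poissonLaw (injection Pr W lam₀ lam₁ t)).prod (freeLaw Pr W t ω)).map
    fun η => η.1 + η.2

end Dynamics

end

end BrownianGas

/-!
The law of a random configuration is determined by its Laplace functional `g ↦ E e^{-ω(g)}`. By
independence, the free dynamics sends `e^{-ω(g)}` to `e^{-ω(V_t g)}` with
`V_t g(x) = -log E_x e^{-g(X_t)}`, and the Poisson injection contributes the factor
`exp(-∫ (1 - e^{-g}) dμ_t)`. The Markov property of the absorbed Brownian motion `X` gives
`V_{s+t} = V_s V_t`, and Chapman-Kolmogorov amounts to the flow property
`μ_{s+t}(f) = μ_t(f) + μ_s(Q_t f)`, where `Q` is the semigroup of the Brownian motion killed at the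
endpoints. Since `μ_t` has density `x ↦ E_x ρ(X_t)`, with `ρ` equal to `λ₀` at `0`, to `λ₁` at `1`
and to `0` inside, this is the Markov property together with the symmetry of `Q`, which comes from
the time reversal of Brownian paths. Configurations stay tempered because `m` is concave and
`E_x X_t = x`, so that `E_x m(X_t) ≤ m(x)`.
-/

namespace BrownianGas

open Filter Topology

section Separability

variable {X Y : Type*} [TopologicalSpace X] [TopologicalSpace Y] {e : X → Y}

lemma continuous_extend_zero [T2Space Y] (he : IsOpenEmbedding e) (f : C₀(X, ℝ)) :
    Continuous (Function.extend e f 0) := by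
  refine continuous_iff_continuousAt.2 fun y => ?_
  by_cases hy : y ∈ Set.range e
  · obtain ⟨x, rfl⟩ := hy
    rw [← he.continuousAt_iff, Function.extend_comp he.injective]
    exact f.continuous.continuousAt
  · rw [ContinuousAt, Function.extend_apply' _ _ _ hy, Pi.zero_apply]
    intro N hN
    obtain ⟨K, hK, hKN⟩ := mem_cocompact.1 (zero_at_infty f hN)
    have hyK : y ∉ e '' K := fun h => hy (Set.image_subset_range e K h)
    refine mem_map.2 ?_
    filter_upwards [(hK.image he.continuous).isClosed.isOpen_compl.mem_nhds hyK] with z hz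
    by_cases hz' : z ∈ Set.range e
    · obtain ⟨x, rfl⟩ := hz'
      rw [Set.mem_preimage, he.injective.extend_apply]
      exact hKN fun hx => hz (Set.mem_image_of_mem e hx)
    · rw [Set.mem_preimage, Function.extend_apply' _ _ _ hz', Pi.zero_apply]
      exact mem_of_mem_nhds hN

lemma dist_extend_zero_eq [T2Space Y] [CompactSpace Y] (he : IsOpenEmbedding e)
    (f g : C₀(X, ℝ)) :
    dist (⟨_, continuous_extend_zero he f⟩ : C(Y, ℝ)) ⟨_, continuous_extend_zero he g⟩ =
      dist f g := by
  refine le_antisymm ((ContinuousMap.dist_le dist_nonneg).2 fun y => ?_)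
    ((BoundedContinuousFunction.dist_le (f := f.toBCF) (g := g.toBCF) dist_nonneg).2 fun x => ?_)
  · by_cases hy : y ∈ Set.range e
    · obtain ⟨x, rfl⟩ := hy
      simp only [ContinuousMap.coe_mk, he.injective.extend_apply]
      exact BoundedContinuousFunction.dist_coe_le_dist (f := f.toBCF) (g := g.toBCF) x
    · simp [Function.extend_apply' _ _ _ hy]
  · change dist (f x) (g x) ≤ _
    have := ContinuousMap.dist_apply_le_dist (f := ⟨_, continuous_extend_zero he f⟩)
      (g := ⟨_, continuous_extend_zero he g⟩) (e x)
    simpa only [ContinuousMap.coe_mk, he.injective.extend_apply] using this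

lemma separableSpace_zeroAtInfty [T2Space Y] [CompactSpace Y] [SecondCountableTopology Y]
    (he : IsOpenEmbedding e) : TopologicalSpace.SeparableSpace C₀(X, ℝ) := by
  have hiso : Isometry fun f : C₀(X, ℝ) => (⟨_, continuous_extend_zero he f⟩ : C(Y, ℝ)) :=
    .of_dist_eq (dist_extend_zero_eq he)
  have := hiso.isEmbedding.secondCountableTopology
  infer_instance

end Separability

section InducedTopology

variable {T Φ : Type*} [PseudoMetricSpace Φ] {e : T → Φ → ℝ}

lemma continuous_of_lipschitzWith_of_dense [TopologicalSpace T] {C : ℝ≥0}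
    (he : ∀ t, LipschitzWith C (e t)) {D : Set Φ} (hD : Dense D)
    (hc : ∀ φ ∈ D, Continuous fun t => e t φ) : Continuous e :=
  continuous_pi fun φ => continuous_iff_continuousAt.2 fun t =>
    ((LipschitzWith.uniformEquicontinuous e C he).equicontinuous φ).tendsto_of_mem_closure
      ((he t).continuous.tendsto φ |>.mono_left nhdsWithin_le_nhds)
      (fun ψ hψ => (hc ψ hψ).tendsto t) (hD φ)

-- On each piece `{L ≤ n}` the topology is already induced by a countable dense set of coordinates.
lemma borel_induced_le_of_lipschitzWith [MeasurableSpace T] [TopologicalSpace.SeparableSpace Φ]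
    {L : T → ℝ≥0} (hL : Measurable L) (hLip : ∀ t, LipschitzWith (L t) (e t))
    (hm : ∀ φ, Measurable fun t => e t φ) :
    @borel T (.induced e Pi.topologicalSpace) ≤ ‹MeasurableSpace T› := by
  refine MeasurableSpace.generateFrom_le fun U hU => ?_
  obtain ⟨O, hO, rfl⟩ := isOpen_induced_iff.1 hU
  obtain ⟨D, hDc, hD⟩ := TopologicalSpace.exists_countable_dense Φ
  have : Countable D := hDc.to_subtype
  let F (t : T) : D → ℝ := fun φ => e t φ
  have hF : Measurable F := measurable_pi_lambda _ fun φ => hm φ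
  let piece (n : ℕ) : Set T := {t | L t ≤ n}
  have open_on_piece (n : ℕ) :
      ∃ V : Set (D → ℝ), IsOpen V ∧ piece n ∩ e ⁻¹' O = piece n ∩ F ⁻¹' V := by
    let : TopologicalSpace (piece n) := .induced (fun t => F t) Pi.topologicalSpace
    have hF : Continuous fun t : piece n => F t := continuous_induced_dom
    have he : Continuous fun t : piece n => e t :=
      continuous_of_lipschitzWith_of_dense (fun t => (hLip t).weaken t.2) hD
        fun φ hφ => (continuous_apply (⟨φ, hφ⟩ : D)).comp hF
    obtain ⟨V, hV, hVO⟩ := isOpen_induced_iff.1 (hO.preimage he)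
    exact ⟨V, hV, (Subtype.preimage_val_eq_preimage_val_iff _ _ _).1 hVO.symm⟩
  choose V hV hVO using open_on_piece
  have hcover : ⋃ n, piece n = Set.univ :=
    Set.eq_univ_of_forall fun t => Set.mem_iUnion.2 (exists_nat_ge (L t))
  rw [← Set.univ_inter (e ⁻¹' O), ← hcover, Set.iUnion_inter]
  simp_rw [hVO]
  exact .iUnion fun n => (hL measurableSet_Iic).inter (hF (hV n).measurableSet)

end InducedTopology

section MeasurableFamilies

variable {A X : Type*} [MeasurableSpace A]

lemma borel_eq_generateFrom_isCompact [TopologicalSpace X] [T2Space X] [SigmaCompactSpace X] :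
    borel X = .generateFrom {K | IsCompact K} := by
  refine le_antisymm ?_ (MeasurableSpace.generateFrom_le fun K hK => ?_)
  · rw [borel_eq_generateFrom_isClosed]
    refine MeasurableSpace.generateFrom_le fun F hF => ?_
    rw [← Set.inter_univ F, ← iUnion_compactCovering X, Set.inter_iUnion]
    exact .iUnion fun n => MeasurableSpace.measurableSet_generateFrom
      ((isCompact_compactCovering X n).inter_left hF)
  · borelize X
    exact hK.measurableSet

variable [MeasurableSpace X]

lemma measurable_measure_of_isCompact [TopologicalSpace X] [T2Space X] [SigmaCompactSpace X]
    [BorelSpace X] {κ : A → Measure X} [∀ a, IsFiniteMeasure (κ a)]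
    (h : ∀ K, IsCompact K → Measurable fun a => κ a K) : Measurable κ := by
  refine .measure_of_isPiSystem (BorelSpace.measurable_eq.trans borel_eq_generateFrom_isCompact)
    (fun K hK L hL _ => hK.inter hL) h ?_
  refine measurable_of_tendsto_metrizable (fun n => h _ (isCompact_compactCovering X n))
    (tendsto_pi_nhds.2 fun a => ?_)
  rw [← iUnion_compactCovering X]
  exact tendsto_measure_iUnion_atTop fun _ _ hkl => compactCovering_subset X hkl

lemma measurable_measure_of_integral [TopologicalSpace X] [LocallyCompactSpace X]
    [TopologicalSpace.MetrizableSpace X] [SigmaCompactSpace X] [BorelSpace X]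
    {κ : A → Measure X} [∀ a, IsFiniteMeasure (κ a)]
    (h : ∀ f : C(X, ℝ), HasCompactSupport f → Measurable fun a => ∫ x, f x ∂κ a) :
    Measurable κ := by
  let := TopologicalSpace.metrizableSpaceMetric X
  refine measurable_measure_of_isCompact fun K hK => ?_
  obtain ⟨f, hfK, -, hf, hf01⟩ := exists_continuous_one_zero_of_isCompact_of_isGδ hK
    hK.isClosed.isGδ isClosed_empty (Set.disjoint_empty K)
  have tendsto_pow (x : X) : Tendsto (fun n => f x ^ n) atTop (𝓝 (K.indicator 1 x)) := by
    by_cases hx : x ∈ K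
    · have : f x = 1 := hfK.subset hx
      simp [this, hx]
    · have : f x ≠ 1 := fun h => hx (hfK.superset h)
      simpa [hx] using tendsto_pow_atTop_nhds_zero_of_lt_one (hf01 x).1
        (lt_of_le_of_ne (hf01 x).2 this)
  have tendsto_integral (a : A) :
      Tendsto (fun n => ∫ x, f x ^ (n + 1) ∂κ a) atTop (𝓝 ((κ a).real K)) := by
    rw [← integral_indicator_one hK.measurableSet]
    refine tendsto_integral_of_dominated_convergence (fun _ => 1)
      (fun n => by fun_prop) (integrable_const 1) (fun n => ae_of_all _ fun x => ?_)
      (ae_of_all _ fun x => (tendsto_pow x).comp (tendsto_add_atTop_nat 1))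
    rw [Real.norm_of_nonneg (pow_nonneg (hf01 x).1 _)]
    exact pow_le_one₀ (hf01 x).1 (hf01 x).2
  have hreal (a : A) : κ a K = ENNReal.ofReal ((κ a).real K) := (ofReal_measureReal).symm
  simp_rw [hreal]
  refine (measurable_of_tendsto_metrizable (fun n => h (f ^ (n + 1)) ?_)
    (tendsto_pi_nhds.2 tendsto_integral)).ennreal_ofReal
  exact hf.comp_left (g := fun r => r ^ (n + 1)) (by simp)

lemma lipschitzWith_integral [TopologicalSpace X] [OpensMeasurableSpace X] (μ : Measure X)
    [IsFiniteMeasure μ] :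
    LipschitzWith (μ Set.univ).toNNReal fun f : BoundedContinuousFunction X ℝ => ∫ x, f x ∂μ := by
  refine LipschitzWith.of_dist_le_mul fun f g => ?_
  rw [dist_eq_norm, ← integral_sub (f.integrable μ) (g.integrable μ), mul_comm]
  exact norm_integral_le_of_norm_le_const (ae_of_all _ fun x =>
    (dist_eq_norm (f x) (g x)).symm.trans_le (f.dist_coe_le_dist x))

lemma measurable_lintegral_param {κ : A → Measure X} (hκ : Measurable κ)
    [∀ a, IsFiniteMeasure (κ a)] {f : A → X → ℝ≥0∞} (hf : Measurable (Function.uncurry f)) :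
    Measurable fun a => ∫⁻ x, f a x ∂κ a := by
  have hmass : Measurable fun a => κ a Set.univ := (Measure.measurable_coe .univ).comp hκ
  let η : Kernel A X := ⟨fun a => (κ a Set.univ)⁻¹ • κ a,
    Measure.measurable_of_measurable_coe _ fun s hs =>
      hmass.inv.mul ((Measure.measurable_coe hs).comp hκ)⟩
  have : IsFiniteKernel η := ⟨1, ENNReal.one_lt_top, fun a => ENNReal.inv_mul_le_one _⟩
  have h (a : A) : ∫⁻ x, f a x ∂κ a = κ a Set.univ * ∫⁻ x, f a x ∂η a := by
    change _ = _ * ∫⁻ x, f a x ∂((κ a Set.univ)⁻¹ • κ a)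
    rcases eq_or_ne (κ a) 0 with h0 | h0
    · simp [h0]
    · rw [lintegral_smul_measure, smul_eq_mul, ← mul_assoc, ENNReal.mul_inv_cancel
        (mt Measure.measure_univ_eq_zero.1 h0) (measure_ne_top _ _), one_mul]
  simp_rw [h]
  exact hmass.mul (hf.lintegral_kernel_prod_right (κ := η))

end MeasurableFamilies

instance : LocallyCompactSpace I01 := isOpen_Ioo.locallyCompactSpace

lemma m_pos (x : I01) : 0 < m x := mul_pos x.2.1 (sub_pos.2 x.2.2)

@[fun_prop]
lemma measurable_ofReal_m : Measurable fun x : I01 => ENNReal.ofReal (m x) := by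
  unfold m
  fun_prop

namespace Configuration

@[simp]
lemma toMeasure_add (ω η : Configuration) : (ω + η).toMeasure = ω.toMeasure + η.toMeasure := rfl

@[simp]
lemma toMeasure_zero : (0 : Configuration).toMeasure = 0 := rfl

/-- The finite measure `m ω`, through which both the topology of `Ω` and the integrals against `ω`
are expressed. -/
noncomputable def weighted (ω : Configuration) : Measure I01 :=
  ω.toMeasure.withDensity fun x => ENNReal.ofReal (m x)

instance (ω : Configuration) : IsFiniteMeasure ω.weighted :=
  ⟨by simpa [weighted] using ω.isConfiguration.tempered⟩

lemma integral_m_mul (ω : Configuration) (φ : I01 → ℝ) :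
    ∫ x, m x * φ x ∂ω.toMeasure = ∫ x, φ x ∂ω.weighted := by
  rw [weighted, integral_withDensity_eq_integral_toReal_smul measurable_ofReal_m (by simp)]
  simp [ENNReal.toReal_ofReal (m_nonneg _)]

lemma lintegral_eq_lintegral_weighted (ω : Configuration) {f : I01 → ℝ≥0∞} (hf : Measurable f) :
    ∫⁻ x, f x ∂ω.toMeasure = ∫⁻ x, (ENNReal.ofReal (m x))⁻¹ * f x ∂ω.weighted := by
  rw [weighted, lintegral_withDensity_eq_lintegral_mul _ measurable_ofReal_m (by fun_prop)]
  refine lintegral_congr fun x => ?_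
  rw [Pi.mul_apply, ENNReal.mul_inv_cancel_left (by simpa using m_pos x) ENNReal.ofReal_ne_top]

lemma lipschitzWith_integral_m_mul (ω : Configuration) :
    LipschitzWith (ω.weighted Set.univ).toNNReal
      fun φ : C₀(I01, ℝ) => ∫ x, m x * φ x ∂ω.toMeasure := by
  simp_rw [integral_m_mul]
  exact fun φ ψ => lipschitzWith_integral ω.weighted φ.toBCF ψ.toBCF

lemma borel_le_comap_toMeasure :
    borel Configuration ≤ MeasurableSpace.comap toMeasure Measure.instMeasurableSpace := by
  have : TopologicalSpace.SeparableSpace C₀(I01, ℝ) :=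
    separableSpace_zeroAtInfty (Y := Set.Icc (0 : ℝ) 1) (e := Set.inclusion Set.Ioo_subset_Icc_self)
      ⟨.inclusion _, by
        rw [Set.range_inclusion]
        exact isOpen_Ioo.preimage continuous_subtype_val⟩
  let : MeasurableSpace Configuration :=
    MeasurableSpace.comap toMeasure Measure.instMeasurableSpace
  have htoMeasure : Measurable toMeasure := comap_measurable _
  have hweighted : Measurable weighted := by
    refine Measure.measurable_of_measurable_coe _ fun s hs => ?_
    simp_rw [weighted, withDensity_apply _ hs, ← lintegral_indicator hs]
    exact (Measure.measurable_lintegral (measurable_ofReal_m.indicator hs)).comp htoMeasure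
  refine borel_induced_le_of_lipschitzWith
    ((Measure.measurable_coe .univ).comp hweighted).ennreal_toNNReal
    lipschitzWith_integral_m_mul fun φ => ?_
  have hφ := φ.continuous.measurable
  simp_rw [integral_m_mul]
  exact (hφ.stronglyMeasurable.integral_kernel (κ := ⟨weighted, hweighted⟩)).measurable

lemma measurable_weighted : Measurable weighted := by
  refine measurable_measure_of_integral fun f hf => ?_
  let φ : C₀(I01, ℝ) := ⟨f, hf.is_zero_at_infty⟩
  have h : Continuous fun (ω : Configuration) (φ : C₀(I01, ℝ)) => ∫ x, m x * φ x ∂ω.toMeasure :=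
    continuous_induced_dom
  simp_rw [← integral_m_mul]
  exact (continuous_pi_iff.1 h φ).measurable

lemma measurable_toMeasure : Measurable toMeasure := by
  refine Measure.measurable_of_measurable_coe _ fun s hs => ?_
  have hs' : Measurable (s.indicator (1 : I01 → ℝ≥0∞)) := measurable_one.indicator hs
  simp_rw [← lintegral_indicator_one hs, lintegral_eq_lintegral_weighted _ hs']
  exact (Measure.measurable_lintegral (measurable_ofReal_m.inv.mul hs')).comp measurable_weighted

lemma measurableSpace_eq_comap_toMeasure :
    (inferInstance : MeasurableSpace Configuration) =
      MeasurableSpace.comap toMeasure Measure.instMeasurableSpace :=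
  le_antisymm borel_le_comap_toMeasure measurable_toMeasure.comap_le

lemma measurable_iff_toMeasure {X : Type*} [MeasurableSpace X] {f : X → Configuration} :
    Measurable f ↔ Measurable fun x => (f x).toMeasure := by
  refine ⟨measurable_toMeasure.comp, fun h => measurable_iff_comap_le.2 ?_⟩
  change MeasurableSpace.comap f (inferInstance : MeasurableSpace Configuration) ≤ _
  rw [measurableSpace_eq_comap_toMeasure, MeasurableSpace.comap_comp]
  exact h.comap_le

lemma measurable_add : Measurable fun p : Configuration × Configuration => p.1 + p.2 := by
  refine measurable_iff_toMeasure.2 (Measure.measurable_of_measurable_coe _ fun s hs => ?_)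
  have hs' := (Measure.measurable_coe hs).comp measurable_toMeasure
  exact (hs'.comp measurable_fst).add (hs'.comp measurable_snd)

lemma measurable_lintegral_toMeasure {A : Type*} [MeasurableSpace A] {f : A → I01 → ℝ≥0∞}
    (hf : Measurable (Function.uncurry f)) :
    Measurable fun p : A × Configuration => ∫⁻ x, f p.1 x ∂p.2.toMeasure := by
  simp_rw [fun p : A × Configuration =>
    lintegral_eq_lintegral_weighted p.2 (hf.of_uncurry_left (x := p.1))]
  exact measurable_lintegral_param (κ := fun p : A × Configuration => p.2.weighted)
    (measurable_weighted.comp measurable_snd)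
    ((measurable_ofReal_m.inv.comp measurable_snd).mul
      (hf.comp (measurable_fst.fst.prodMk measurable_snd)))

end Configuration

section MultiplicativeClass

variable {A X : Type*} [mA : MeasurableSpace A] [mX : MeasurableSpace X]

lemma measurable_measure_of_submonoid_continuousMap [TopologicalSpace X] [CompactSpace X]
    [TopologicalSpace.MetrizableSpace X] [BorelSpace X] {κ : A → Measure X}
    [∀ a, IsFiniteMeasure (κ a)] {M : Submonoid C(X, ℝ)}
    (hM : ∀ x y, x ≠ y → ∃ f ∈ M, f x ≠ f y)
    (h : ∀ f ∈ M, Measurable fun a => ∫ x, f x ∂κ a) : Measurable κ := by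
  have hint (f : C(X, ℝ)) (a : A) : Integrable f (κ a) :=
    .of_bound f.continuous.aestronglyMeasurable ‖f‖ (ae_of_all _ f.norm_coe_le_norm)
  let S := Algebra.adjoin ℝ (M : Set C(X, ℝ))
  have hS : ∀ f ∈ S, Measurable fun a => ∫ x, f x ∂κ a := by
    intro f hf
    rw [← Subalgebra.mem_toSubmodule, Algebra.adjoin_eq_span, Submonoid.closure_eq] at hf
    induction hf using Submodule.span_induction with
    | mem f hf => exact h f hf
    | zero => simp
    | add f g _ _ hf hg =>
      simp only [ContinuousMap.add_apply]
      simp_rw [integral_add (hint _ _) (hint _ _)]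
      exact hf.add hg
    | smul c f _ hf =>
      simp only [ContinuousMap.smul_apply]
      simp_rw [integral_smul]
      exact hf.const_smul c
  have hsep : S.SeparatesPoints := fun x y hxy =>
    let ⟨f, hf, hne⟩ := hM x y hxy
    ⟨f, ⟨f, Algebra.subset_adjoin hf, rfl⟩, hne⟩
  refine measurable_measure_of_integral fun f _ => ?_
  obtain ⟨u, hu, hlim⟩ : ∃ u : ℕ → C(X, ℝ), (∀ n, u n ∈ S) ∧ Tendsto u atTop (𝓝 f) := by
    refine mem_closure_iff_seq_limit.1 ?_
    rw [← Subalgebra.topologicalClosure_coe,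
      ContinuousMap.subalgebra_topologicalClosure_eq_top_of_separatesPoints S hsep]
    trivial
  refine measurable_of_tendsto_metrizable (fun n => hS _ (hu n)) (tendsto_pi_nhds.2 fun a => ?_)
  exact ((lipschitzWith_integral (κ a)).continuous.comp
    (ContinuousMap.isometryEquivBoundedOfCompact X ℝ).continuous).tendsto f |>.comp hlim

lemma measurable_measure_of_marginals {ι : Type*} {α : ι → Type*} [∀ i, MeasurableSpace (α i)]
    {κ : A → Measure (∀ i, α i)} [∀ a, IsFiniteMeasure (κ a)]
    (h : ∀ I : Finset ι, Measurable fun a => (κ a).map I.restrict) : Measurable κ := by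
  have hcyl : ∀ s ∈ measurableCylinders α, Measurable fun a => κ a s := by
    intro s hs
    obtain ⟨I, F, hF, rfl⟩ := (mem_measurableCylinders s).1 hs
    simp_rw [cylinder, ← Measure.map_apply (Finset.measurable_restrict I) hF]
    exact (Measure.measurable_coe hF).comp (h I)
  exact .measure_of_isPiSystem generateFrom_measurableCylinders.symm isPiSystem_measurableCylinders
    hcyl (hcyl _ (univ_mem_measurableCylinders _))

lemma measurable_measure_of_submonoid {κ : A → Measure X} [∀ a, IsFiniteMeasure (κ a)]
    {M : Submonoid (X → unitInterval)} (hM : ∀ f ∈ M, Measurable f)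
    (hle : mX ≤ .comap (fun x (f : M) => f.1 x) .pi)
    (h : ∀ f ∈ M, Measurable fun a => ∫ x, (f x : ℝ) ∂κ a) : Measurable κ := by
  let e (x : X) (f : M) : unitInterval := f.1 x
  have he : Measurable e := measurable_pi_lambda _ fun f => hM f.1 f.2
  suffices hmap : Measurable fun a => (κ a).map e by
    refine Measure.measurable_of_measurable_coe _ fun B hB => ?_
    obtain ⟨C, hC, rfl⟩ := hle B hB
    change Measurable fun a => κ a (e ⁻¹' C)
    simp_rw [← Measure.map_apply he hC]
    exact (Measure.measurable_coe hC).comp hmap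
  refine measurable_measure_of_marginals fun I => ?_
  have hI : Measurable (I.restrict ∘ e) := (Finset.measurable_restrict I).comp he
  simp_rw [Measure.map_map (Finset.measurable_restrict I) he]
  let N : Submonoid C(I → unitInterval, ℝ) :=
    { carrier := {G | ∃ f ∈ M, ∀ x, G (I.restrict (e x)) = f x}
      one_mem' := ⟨1, M.one_mem, fun _ => rfl⟩
      mul_mem' := fun ⟨f, hf, hf'⟩ ⟨g, hg, hg'⟩ =>
        ⟨f * g, M.mul_mem hf hg, fun x => by simp [hf', hg']⟩ }
  refine measurable_measure_of_submonoid_continuousMap (M := N) (fun x y hxy => ?_) ?_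
  · obtain ⟨i, hi⟩ := Function.ne_iff.1 hxy
    exact ⟨⟨fun x => x i, by fun_prop⟩, ⟨i.1.1, i.1.2, fun _ => rfl⟩,
      fun h => hi (Subtype.ext h)⟩
  · rintro G ⟨f, hf, hG⟩
    simp_rw [integral_map hI.aemeasurable G.continuous.aestronglyMeasurable, Function.comp, hG]
    exact h f hf

lemma measure_ext_of_submonoid {P Q : Measure X} [IsFiniteMeasure P] [IsFiniteMeasure Q]
    {M : Submonoid (X → unitInterval)} (hM : ∀ f ∈ M, Measurable f)
    (hle : mX ≤ .comap (fun x (f : M) => f.1 x) .pi)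
    (h : ∀ f ∈ M, ∫ x, (f x : ℝ) ∂P = ∫ x, (f x : ℝ) ∂Q) : P = Q := by
  let κ (b : Bool) : Measure X := if b then P else Q
  have (b : Bool) : IsFiniteMeasure (κ b) := by cases b <;> assumption
  have hκ : Measurable[⊥] κ := by
    refine measurable_measure_of_submonoid (mA := ⊥) hM hle fun f hf => ?_
    have hconst : (fun b => ∫ x, (f x : ℝ) ∂κ b) = fun _ => ∫ x, (f x : ℝ) ∂P := by
      ext b
      cases b
      · exact (h f hf).symm
      · rfl
    rw [hconst]
    exact measurable_const
  ext B hB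
  obtain ⟨c, hc⟩ := eq_const_of_measurable_bot ((Measure.measurable_coe hB).comp hκ)
  exact (congrFun hc true).trans (congrFun hc false).symm

end MultiplicativeClass

/-! ### Laplace functionals -/

/-- The function `a ↦ e^{-a}` on `[0, ∞]`. -/
noncomputable def expNeg (a : ℝ≥0∞) : ℝ≥0∞ := (EReal.exp a)⁻¹

/-- The inverse `q ↦ -log q` of `expNeg` on `[0, 1]`. -/
noncomputable def negLog (q : ℝ≥0∞) : ℝ≥0∞ := (ENNReal.log q⁻¹).toENNReal

@[simp]
lemma expNeg_zero : expNeg 0 = 1 := by simp [expNeg]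

lemma one_le_exp_coe (a : ℝ≥0∞) : 1 ≤ EReal.exp a :=
  EReal.one_le_exp_iff.2 (EReal.coe_ennreal_nonneg a)

lemma expNeg_le_one (a : ℝ≥0∞) : expNeg a ≤ 1 := ENNReal.inv_le_one.2 (one_le_exp_coe a)

lemma expNeg_ne_top (a : ℝ≥0∞) : expNeg a ≠ ∞ := ne_top_of_le_ne_top (by simp) (expNeg_le_one a)

lemma expNeg_add (a b : ℝ≥0∞) : expNeg (a + b) = expNeg a * expNeg b := by
  have h (c : ℝ≥0∞) : EReal.exp c ≠ 0 := (zero_lt_one.trans_le (one_le_exp_coe c)).ne'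
  rw [expNeg, EReal.coe_ennreal_add, EReal.exp_add, ENNReal.mul_inv (.inl (h a)) (.inr (h b))]
  rfl

lemma continuous_expNeg : Continuous expNeg :=
  (ENNReal.continuous_exp.comp continuous_coe_ennreal_ereal).inv

@[fun_prop]
lemma measurable_expNeg : Measurable expNeg := continuous_expNeg.measurable

lemma expNeg_sum {ι : Type*} (s : Finset ι) (f : ι → ℝ≥0∞) :
    expNeg (∑ i ∈ s, f i) = ∏ i ∈ s, expNeg (f i) := by
  classical
  induction s using Finset.induction_on with
  | empty => simp
  | insert i s hi ih => rw [Finset.sum_insert hi, Finset.prod_insert hi, expNeg_add, ih]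

lemma tendsto_prod_expNeg {ι : Type*} (f : ι → ℝ≥0∞) :
    Tendsto (fun s : Finset ι => ∏ i ∈ s, expNeg (f i)) atTop (𝓝 (expNeg (∑' i, f i))) := by
  simp_rw [← expNeg_sum]
  exact (continuous_expNeg.tendsto _).comp ENNReal.summable.hasSum

lemma negLog_expNeg (a : ℝ≥0∞) : negLog (expNeg a) = a := by
  simp [negLog, expNeg]

lemma expNeg_negLog {q : ℝ≥0∞} (hq : q ≤ 1) : expNeg (negLog q) = q := by
  rw [expNeg, negLog, EReal.coe_toENNReal, ENNReal.exp_log, inv_inv]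
  rw [ENNReal.zero_le_log_iff]
  exact ENNReal.one_le_inv.2 hq

@[fun_prop]
lemma measurable_negLog : Measurable negLog :=
  (ENNReal.measurable_log.comp measurable_inv).ereal_toENNReal

lemma expNeg_ofReal {r : ℝ} (hr : 0 ≤ r) :
    expNeg (ENNReal.ofReal r) = ENNReal.ofReal (Real.exp (-r)) := by
  rw [expNeg, EReal.coe_ennreal_ofReal, max_eq_left hr, EReal.exp_coe,
    ← ENNReal.ofReal_inv_of_pos (Real.exp_pos r), Real.exp_neg]

attribute [irreducible] expNeg negLog

namespace Configuration

/-- The random variable `ω ↦ e^{-ω(g)}`, whose mean is the Laplace functional of a random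
configuration at `g`. -/
noncomputable def laplaceVar (g : I01 → ℝ≥0∞) (ω : Configuration) : ℝ≥0∞ :=
  expNeg (∫⁻ x, g x ∂ω.toMeasure)

lemma measurable_laplaceVar {g : I01 → ℝ≥0∞} (hg : Measurable g) : Measurable (laplaceVar g) :=
  measurable_expNeg.comp ((Measure.measurable_lintegral hg).comp measurable_toMeasure)

lemma laplaceVar_ne_top (g : I01 → ℝ≥0∞) (ω : Configuration) : laplaceVar g ω ≠ ∞ :=
  expNeg_ne_top _

lemma laplaceVar_add {g : I01 → ℝ≥0∞} (hg : Measurable g) (h : I01 → ℝ≥0∞) (ω : Configuration) :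
    laplaceVar (g + h) ω = laplaceVar g ω * laplaceVar h ω := by
  simp [laplaceVar, lintegral_add_left hg, expNeg_add]

lemma laplaceVar_add_configuration (g : I01 → ℝ≥0∞) (ω η : Configuration) :
    laplaceVar g (ω + η) = laplaceVar g ω * laplaceVar g η := by
  simp [laplaceVar, lintegral_add_measure, expNeg_add]

/-- The variables `ω ↦ e^{-ω(g)}`, `g` measurable, as a submonoid of the `[0, 1]`-valued
functions on `Ω`. -/
def laplaceSubmonoid : Submonoid (Configuration → unitInterval) where
  carrier := {F | ∃ g, Measurable g ∧ ∀ ω, (F ω : ℝ) = (laplaceVar g ω).toReal}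
  one_mem' := ⟨0, measurable_zero, fun ω => by simp [laplaceVar]⟩
  mul_mem' := fun ⟨g, hg, hF⟩ ⟨h, hh, hG⟩ =>
    ⟨g + h, hg.add hh, fun ω => by simp [laplaceVar_add hg, hF, hG]⟩

lemma exists_mem_laplaceSubmonoid {g : I01 → ℝ≥0∞} (hg : Measurable g) :
    ∃ F ∈ laplaceSubmonoid, ∀ ω, (F ω : ℝ) = (laplaceVar g ω).toReal :=
  ⟨fun ω => ⟨(laplaceVar g ω).toReal, ENNReal.toReal_nonneg,
    ENNReal.toReal_mono (by simp) (expNeg_le_one _)⟩, ⟨g, hg, fun _ => rfl⟩, fun _ => rfl⟩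

lemma measurable_of_mem_laplaceSubmonoid {F : Configuration → unitInterval}
    (hF : F ∈ laplaceSubmonoid) : Measurable F := by
  obtain ⟨g, hg, hFg⟩ := hF
  refine (MeasurableEmbedding.subtype_coe measurableSet_Icc).measurable_comp_iff.1 ?_
  simp_rw [Function.comp_def, hFg]
  exact (measurable_laplaceVar hg).ennreal_toReal

lemma integral_of_mem_laplaceSubmonoid {F : Configuration → unitInterval} {g : I01 → ℝ≥0∞}
    (hg : Measurable g) (hF : ∀ ω, (F ω : ℝ) = (laplaceVar g ω).toReal)
    (P : Measure Configuration) :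
    ∫ ω, (F ω : ℝ) ∂P = (∫⁻ ω, laplaceVar g ω ∂P).toReal := by
  simp_rw [hF]
  exact integral_toReal (measurable_laplaceVar hg).aemeasurable
    (ae_of_all _ fun ω => (laplaceVar_ne_top g ω).lt_top)

lemma measurableSpace_le_comap_laplaceSubmonoid :
    (inferInstance : MeasurableSpace Configuration) ≤
      .comap (fun ω (F : laplaceSubmonoid) => F.1 ω) .pi := by
  let e (ω : Configuration) (F : laplaceSubmonoid) : unitInterval := F.1 ω
  rw [measurableSpace_eq_comap_toMeasure, ← measurable_iff_comap_le]
  refine @Measure.measurable_of_measurable_coe _ _ _ (.comap e .pi) _ fun s hs => ?_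
  obtain ⟨F, hF, hFs⟩ := exists_mem_laplaceSubmonoid (measurable_one.indicator hs)
  have h (ω : Configuration) : ω.toMeasure s = negLog (ENNReal.ofReal (e ω ⟨F, hF⟩)) := by
    rw [hFs, ENNReal.ofReal_toReal (laplaceVar_ne_top _ _), laplaceVar, negLog_expNeg,
      lintegral_indicator_one hs]
  simp_rw [h]
  exact measurable_negLog.comp (measurable_subtype_coe.comp
    ((measurable_pi_apply _).comp (comap_measurable e))).ennreal_ofReal

lemma measurable_measure_of_laplace {A : Type*} [MeasurableSpace A] {κ : A → Measure Configuration}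
    [∀ a, IsFiniteMeasure (κ a)]
    (h : ∀ g, Measurable g → Measurable fun a => ∫⁻ ω, laplaceVar g ω ∂κ a) : Measurable κ := by
  refine measurable_measure_of_submonoid (fun F => measurable_of_mem_laplaceSubmonoid)
    measurableSpace_le_comap_laplaceSubmonoid fun F ⟨g, hg, hF⟩ => ?_
  simp_rw [integral_of_mem_laplaceSubmonoid hg hF]
  exact (h g hg).ennreal_toReal

lemma measure_ext_of_laplace {P Q : Measure Configuration} [IsFiniteMeasure P] [IsFiniteMeasure Q]
    (h : ∀ g, Measurable g → ∫⁻ ω, laplaceVar g ω ∂P = ∫⁻ ω, laplaceVar g ω ∂Q) : P = Q := by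
  refine measure_ext_of_submonoid (fun F => measurable_of_mem_laplaceSubmonoid)
    measurableSpace_le_comap_laplaceSubmonoid fun F ⟨g, hg, hF⟩ => ?_
  simp_rw [integral_of_mem_laplaceSubmonoid hg hF, h g hg]

end Configuration

/-! ### Configurations as countable sums of Dirac masses -/

lemma lintegral_comap_eq_lintegral_extend {X Y : Type*} [MeasurableSpace X] [MeasurableSpace Y]
    {e : X → Y} (he : MeasurableEmbedding e) (μ : Measure Y) (f : X → ℝ≥0∞) :
    ∫⁻ x, f x ∂μ.comap e = ∫⁻ y, Function.extend e f 0 y ∂μ := by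
  have h : (Set.range e).indicator (Function.extend e f 0) = Function.extend e f 0 :=
    Set.indicator_eq_self.2 fun y hy => by_contra fun hye => hy (Function.extend_apply' _ _ _ hye)
  rw [← h, lintegral_indicator he.measurableSet_range, ← he.map_comap, he.lintegral_map]
  simp_rw [he.injective.extend_apply]

lemma exists_sum_dirac_eq_natCast {X ι : Type*} [MeasurableSpace X] (y : ι → X) {A : Set X}
    (hA : MeasurableSet A) :
    ∃ n : ℕ∞, (Measure.sum fun i => Measure.dirac (y i)) A = (n : ℝ≥0∞) := by
  refine ⟨(y ⁻¹' A).encard, ?_⟩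
  rw [Measure.sum_apply _ hA, ← ENNReal.tsum_set_one, tsum_subtype _ fun _ => (1 : ℝ≥0∞)]
  exact tsum_congr fun i => Measure.dirac_apply' _ hA

lemma measure_lt_top_of_isCompact {X : Type*} [TopologicalSpace X] [MeasurableSpace X]
    [OpensMeasurableSpace X] {μ : Measure X} {f : X → ℝ≥0∞} (hf : Continuous f)
    (hpos : ∀ x, f x ≠ 0) (hfin : ∫⁻ x, f x ∂μ < ∞) {K : Set X} (hK : IsCompact K) : μ K < ∞ := by
  rcases K.eq_empty_or_nonempty with rfl | hne
  · simp
  obtain ⟨x, -, hx : ∀ z ∈ K, f x ≤ f z⟩ := hK.exists_isMinOn hne hf.continuousOn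
  have hε : min (f x) 1 ≠ 0 := (lt_min (pos_iff_ne_zero.2 (hpos x)) one_pos).ne'
  calc μ K ≤ μ {z | min (f x) 1 ≤ f z} := measure_mono fun z hz => (min_le_left _ _).trans (hx z hz)
    _ ≤ (∫⁻ z, f z ∂μ) / min (f x) 1 :=
      meas_ge_le_lintegral_div hf.aemeasurable hε (by simp)
    _ < ∞ := ENNReal.div_lt_top hfin.ne hε

lemma measurableEmbedding_coe : MeasurableEmbedding ((↑) : I01 → ℝ) :=
  .subtype_coe measurableSet_Ioo

/-- The extension by zero to `ℝ` of a function on `(0,1)`. -/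
noncomputable def zeroExt (f : I01 → ℝ≥0∞) : ℝ → ℝ≥0∞ := Function.extend (↑) f 0

@[simp]
lemma zeroExt_coe (f : I01 → ℝ≥0∞) (x : I01) : zeroExt f x = f x :=
  Subtype.val_injective.extend_apply f 0 x

lemma zeroExt_of_notMem (f : I01 → ℝ≥0∞) {y : ℝ} (hy : y ∉ Set.Ioo (0 : ℝ) 1) :
    zeroExt f y = 0 :=
  Function.extend_apply' _ _ _ fun ⟨x, hx⟩ => hy (hx ▸ x.2)

@[fun_prop]
lemma measurable_zeroExt {f : I01 → ℝ≥0∞} (hf : Measurable f) : Measurable (zeroExt f) :=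
  measurableEmbedding_coe.measurable_extend hf measurable_zero

lemma lintegral_comap_sum_dirac {ι : Type*} (y : ι → ℝ) {f : I01 → ℝ≥0∞} (hf : Measurable f) :
    ∫⁻ x, f x ∂(Measure.sum fun i => Measure.dirac (y i)).comap ((↑) : I01 → ℝ) =
      ∑' i, zeroExt f (y i) := by
  rw [lintegral_comap_eq_lintegral_extend measurableEmbedding_coe, lintegral_sum_measure]
  exact tsum_congr fun i => lintegral_dirac' _ (measurable_zeroExt hf)

/-- The total weight `∑ᵢ m(yᵢ)` of the points of the family `y` in `(0,1)`. -/
noncomputable def totalWeight {ι : Type*} (y : ι → ℝ) : ℝ≥0∞ :=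
  ∑' i, zeroExt (fun x => ENNReal.ofReal (m x)) (y i)

lemma isConfiguration_sum_dirac_iff {ι : Type*} (y : ι → ℝ) :
    IsConfiguration ((Measure.sum fun i => Measure.dirac (y i)).comap ((↑) : I01 → ℝ)) ↔
      totalWeight y < ∞ := by
  rw [totalWeight, ← lintegral_comap_sum_dirac y measurable_ofReal_m]
  refine ⟨IsConfiguration.tempered, fun h => ⟨fun K hK => ?_, fun A hA => ?_, h⟩⟩
  · refine measure_lt_top_of_isCompact (ENNReal.continuous_ofReal.comp ?_)
      (fun x => by simpa using m_pos x) h hK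
    unfold m
    fun_prop
  · rw [measurableEmbedding_coe.comap_apply]
    exact exists_sum_dirac_eq_natCast y (measurableEmbedding_coe.measurableSet_image.2 hA)

namespace Configuration

lemma ofPoints_eq_zero {ι : Type*} {y : ι → ℝ} (h : ¬ totalWeight y < ∞) : ofPoints y = 0 := by
  rw [ofPoints, dif_neg ((isConfiguration_sum_dirac_iff y).not.2 h)]

lemma lintegral_ofPoints {ι : Type*} {y : ι → ℝ} (h : totalWeight y < ∞) {f : I01 → ℝ≥0∞}
    (hf : Measurable f) : ∫⁻ x, f x ∂(ofPoints y).toMeasure = ∑' i, zeroExt f (y i) := by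
  rw [ofPoints, dif_pos ((isConfiguration_sum_dirac_iff y).2 h), lintegral_comap_sum_dirac y hf]

lemma laplaceVar_ofPoints {ι : Type*} {y : ι → ℝ} (h : totalWeight y < ∞) {g : I01 → ℝ≥0∞}
    (hg : Measurable g) : laplaceVar g (ofPoints y) = expNeg (∑' i, zeroExt g (y i)) := by
  rw [laplaceVar, lintegral_ofPoints h hg]

open scoped Classical in
lemma measurable_ofPoints {X ι : Type*} [MeasurableSpace X] [Countable ι] {y : X → ι → ℝ}
    (hy : ∀ i, Measurable fun x => y x i) : Measurable fun x => ofPoints (y x) := by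
  have hsum {f : I01 → ℝ≥0∞} (hf : Measurable f) : Measurable fun x => ∑' i, zeroExt f (y x i) :=
    .tsum fun i => (measurable_zeroExt hf).comp (hy i)
  refine measurable_iff_toMeasure.2 (Measure.measurable_of_measurable_coe _ fun A hA => ?_)
  have hA' : Measurable (A.indicator (1 : I01 → ℝ≥0∞)) := measurable_one.indicator hA
  have h (x : X) : (ofPoints (y x)).toMeasure A =
      if totalWeight (y x) < ∞ then ∑' i, zeroExt (A.indicator 1) (y x i) else 0 := by
    split_ifs with hx
    · rw [← lintegral_indicator_one hA, lintegral_ofPoints hx hA']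
    · simp [ofPoints_eq_zero hx]
  simp_rw [h]
  exact .ite (hsum measurable_ofReal_m measurableSet_Iio) (hsum hA') measurable_const

section Particles

variable (ω : Configuration)

instance : IsLocallyFiniteMeasure ω.toMeasure :=
  have : IsFiniteMeasureOnCompacts ω.toMeasure := ⟨fun _ => ω.isConfiguration.radon _⟩
  isLocallyFiniteMeasure_of_isFiniteMeasureOnCompacts

/-- The set of points charged by `ω`. -/
def atoms : Set I01 := {x | 0 < ω.toMeasure {x}}

lemma countable_atoms : ω.atoms.Countable :=
  Measure.countable_meas_pos_of_disjoint_iUnion (fun _ => measurableSet_singleton _)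
    fun _ _ h => Set.disjoint_singleton.2 h

-- A point of measure `< 1` has a neighbourhood of measure `< 1`, hence of measure `0`.
lemma measure_compl_atoms : ω.toMeasure ω.atomsᶜ = 0 := by
  refine measure_null_of_locally_null _ fun x hx => ?_
  have hx0 : ω.toMeasure {x} < 1 := by
    have : ω.toMeasure {x} = 0 := by simpa [atoms] using hx
    simp [this]
  obtain ⟨U, hxU, hU, hU1⟩ := Set.exists_isOpen_lt_of_lt _ _ hx0
  refine ⟨U, mem_nhdsWithin_of_mem_nhds (hU.mem_nhds (hxU rfl)), ?_⟩
  obtain ⟨n, hn⟩ := ω.isConfiguration.integer_valued U hU.measurableSet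
  rw [hn] at hU1 ⊢
  have : n < 1 := mod_cast hU1
  simp [Order.lt_one_iff.1 this]

lemma measure_singleton (x : I01) :
    ω.toMeasure {x} = (⌊(ω.toMeasure {x}).toReal⌋₊ : ℝ≥0∞) := by
  obtain ⟨n, hn⟩ := ω.isConfiguration.integer_valued {x} (measurableSet_singleton x)
  have hfin := ω.isConfiguration.radon {x} isCompact_singleton
  rw [hn] at hfin ⊢
  lift n to ℕ using by rintro rfl; simp at hfin
  simp

lemma mem_atoms (p : ω.Particle) : p.1 ∈ ω.atoms := by
  have : 0 < ⌊(ω.toMeasure {p.1}).toReal⌋₊ := p.2.pos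
  rw [atoms, Set.mem_ofPred_eq, measure_singleton]
  exact_mod_cast this

instance : Countable ω.Particle := by
  have := ω.countable_atoms.to_subtype
  refine Function.Injective.countable (β := ω.atoms × ℕ)
    (f := fun p : ω.Particle => (⟨p.1, ω.mem_atoms p⟩, p.2)) ?_
  rintro ⟨x, i⟩ ⟨y, j⟩ h
  simp only [Prod.mk.injEq, Subtype.mk.injEq] at h
  obtain ⟨rfl, h⟩ := h
  exact congrArg (Sigma.mk x) (Fin.ext h)

lemma lintegral_eq_tsum_particle (f : I01 → ℝ≥0∞) :
    ∫⁻ x, f x ∂ω.toMeasure = ∑' p : ω.Particle, f p.1 := by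
  have fiber (x : I01) :
      ∑' _ : Fin ⌊(ω.toMeasure {x}).toReal⌋₊, f x = f x * ω.toMeasure {x} := by
    rw [tsum_fintype, Finset.sum_const, Finset.card_univ, Fintype.card_fin, nsmul_eq_mul, mul_comm,
      ← measure_singleton]
  have outside_atoms : Function.support (fun x => f x * ω.toMeasure {x}) ⊆ ω.atoms :=
    fun x hx => pos_iff_ne_zero.2 (right_ne_zero_of_mul hx)
  calc ∫⁻ x, f x ∂ω.toMeasure = ∫⁻ x in ω.atoms, f x ∂ω.toMeasure := by
        rw [Measure.restrict_eq_self_of_ae_mem (s := ω.atoms) ω.measure_compl_atoms]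
    _ = ∑' x : ω.atoms, f x * ω.toMeasure {(x : I01)} := lintegral_countable f ω.countable_atoms
    _ = ∑' x, f x * ω.toMeasure {x} := tsum_subtype_eq_of_support_subset outside_atoms
    _ = ∑' p : ω.Particle, f p.1 := by
      simp_rw [← fiber]
      exact (ENNReal.tsum_sigma' fun p : ω.Particle => f p.1).symm

end Particles

end Configuration

/-! ### Absorbed paths -/

lemma hittingAfter_le_iff_of_isClosed {ι S X : Type*} [ConditionallyCompleteLinearOrder ι]
    [TopologicalSpace ι] [OrderTopology ι] [TopologicalSpace X] {u : ι → S → X} {F : Set X}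
    (hF : IsClosed F) {s : S} (hu : Continuous fun t => u t s) (n c : ι) :
    hittingAfter u F n s ≤ (c : WithTop ι) ↔ ∃ v ∈ Set.Icc n c, u v s ∈ F := by
  refine ⟨fun h => ?_, fun ⟨v, ⟨hnv, hvc⟩, hvF⟩ =>
    (hittingAfter_le_of_mem hnv hvF).trans (WithTop.coe_le_coe.2 hvc)⟩
  have hex : ∃ j, n ≤ j ∧ u j s ∈ F := by
    by_contra! hne
    rw [hittingAfter_eq_top_iff.2 hne] at h
    exact WithTop.coe_ne_top (top_le_iff.1 h)
  have hclosed : IsClosed {i : ι | n ≤ i ∧ u i s ∈ F} := isClosed_Ici.inter (hF.preimage hu)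
  have hmem := hclosed.csInf_mem hex ⟨n, fun _ hi => hi.1⟩
  rw [hittingAfter, if_pos hex] at h
  exact ⟨_, ⟨hmem.1, WithTop.coe_le_coe.1 h⟩, hmem.2⟩

lemma measurableSet_forall_pos {K X : Type*} [TopologicalSpace K] [CompactSpace K]
    [TopologicalSpace.SeparableSpace K] [MeasurableSpace X] {f : K → X → ℝ}
    (hc : ∀ x, Continuous fun u => f u x) (hm : ∀ u, Measurable (f u)) :
    MeasurableSet {x | ∀ u, 0 < f u x} := by
  obtain ⟨D, hD, hDdense⟩ := TopologicalSpace.exists_countable_dense K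
  have h : {x | ∀ u, 0 < f u x} = ⋃ n : ℕ, ⋂ u ∈ D, {x | 1 / (n + 1 : ℝ) ≤ f u x} := by
    ext x
    simp only [Set.mem_ofPred_eq, Set.mem_iUnion, Set.mem_iInter]
    refine ⟨fun hx => ?_, fun ⟨n, hn⟩ u => ?_⟩
    · obtain ⟨a, ha, hau⟩ :=
        isCompact_univ.exists_forall_le' (hc x).continuousOn fun u _ => hx u
      obtain ⟨n, hn⟩ := exists_nat_one_div_lt ha
      exact ⟨n, fun u _ => hn.le.trans (hau u (Set.mem_univ u))⟩
    · have hclosed : IsClosed {u | 1 / (n + 1 : ℝ) ≤ f u x} := isClosed_le continuous_const (hc x)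
      have hu := hclosed.closure_subset_iff.2 (fun u hu => hn u hu) (hDdense u)
      exact Nat.one_div_pos_of_nat.trans_le hu
  rw [h]
  exact .iUnion fun n => .biInter hD fun u _ => measurableSet_le measurable_const (hm u)

section Path

variable {S : Type*} {W : ℝ≥0 → S → ℝ} {x : ℝ} {s : S}

/-- The time `t ∧ τ`, with `τ` the exit time from `(0,1)` of the path `x + W`. -/
noncomputable def minExitTime (W : ℝ≥0 → S → ℝ) (x : ℝ) (t : ℝ≥0) (s : S) : ℝ≥0 :=
  (min (t : WithTop ℝ≥0) (hittingAfter (fun t s => x + W t s) (Set.Ioo (0 : ℝ) 1)ᶜ 0 s)).untopA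

lemma absorbed_eq (W : ℝ≥0 → S → ℝ) (x : ℝ) (t : ℝ≥0) (s : S) :
    absorbed W x t s = x + W (minExitTime W x t s) s := rfl

lemma minExitTime_le_iff (hW : Continuous fun t => W t s) {t c : ℝ≥0} :
    minExitTime W x t s ≤ c ↔ t ≤ c ∨ ∃ u ≤ c, x + W u s ∉ Set.Ioo (0 : ℝ) 1 := by
  rw [minExitTime, WithTop.untopA_le_iff ((min_le_left _ _).trans_lt (WithTop.coe_lt_top t)).ne,
    min_le_iff, WithTop.coe_le_coe,
    hittingAfter_le_iff_of_isClosed isOpen_Ioo.isClosed_compl (by fun_prop)]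
  simp

lemma minExitTime_le (hW : Continuous fun t => W t s) (t : ℝ≥0) : minExitTime W x t s ≤ t :=
  (minExitTime_le_iff hW).2 (.inl le_rfl)

lemma mem_Ioo_of_lt_minExitTime (hW : Continuous fun t => W t s) {t u : ℝ≥0}
    (hu : u < minExitTime W x t s) : x + W u s ∈ Set.Ioo (0 : ℝ) 1 := by
  by_contra h
  exact hu.not_ge ((minExitTime_le_iff hW).2 (.inr ⟨u, le_rfl, h⟩))

lemma minExitTime_of_forall_mem (hW : Continuous fun t => W t s) {t : ℝ≥0}
    (h : ∀ u ≤ t, x + W u s ∈ Set.Ioo (0 : ℝ) 1) : minExitTime W x t s = t := by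
  refine eq_of_forall_ge_iff fun c => (minExitTime_le_iff hW).trans ?_
  refine or_iff_left_of_imp fun ⟨u, huc, hu⟩ => ?_
  exact (not_le.1 fun hut => hu (h u hut)).le.trans huc

lemma absorbed_of_forall_mem (hW : Continuous fun t => W t s) {t : ℝ≥0}
    (h : ∀ u ≤ t, x + W u s ∈ Set.Ioo (0 : ℝ) 1) : absorbed W x t s = x + W t s := by
  rw [absorbed_eq, minExitTime_of_forall_mem hW h]

lemma absorbed_mem_Ioo_iff (hW : Continuous fun t => W t s) {t : ℝ≥0} :
    absorbed W x t s ∈ Set.Ioo (0 : ℝ) 1 ↔ ∀ u ≤ t, x + W u s ∈ Set.Ioo (0 : ℝ) 1 := by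
  refine ⟨fun h u hu => ?_, fun h => absorbed_of_forall_mem hW h ▸ h t le_rfl⟩
  rcases lt_trichotomy u (minExitTime W x t s) with hlt | rfl | hgt
  · exact mem_Ioo_of_lt_minExitTime hW hlt
  · exact h
  · obtain htv | ⟨v, hv, hvmem⟩ := (minExitTime_le_iff hW).1 (le_refl (minExitTime W x t s))
    · exact absurd (hgt.trans_le hu) htv.not_gt
    · rcases hv.lt_or_eq with hlt | rfl
      · exact absurd (mem_Ioo_of_lt_minExitTime hW hlt) hvmem
      · exact absurd h hvmem

lemma absorbed_mem_Icc (hW : Continuous fun t => W t s) (h0 : W 0 s = 0)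
    (hx : x ∈ Set.Icc (0 : ℝ) 1) (t : ℝ≥0) : absorbed W x t s ∈ Set.Icc (0 : ℝ) 1 := by
  rw [absorbed_eq]
  rcases eq_zero_or_pos (minExitTime W x t s) with h | h
  · rwa [h, h0, add_zero]
  · have hmem : minExitTime W x t s ∈ closure (Set.Iio (minExitTime W x t s)) := by
      rw [closure_Iio' (a := minExitTime W x t s) ⟨0, h⟩]
      exact Set.self_mem_Iic
    have := map_mem_closure (f := fun u => x + W u s) (by fun_prop) hmem
      fun _ => mem_Ioo_of_lt_minExitTime hW
    rwa [closure_Ioo zero_ne_one] at this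

lemma minExitTime_eq_min (hW : Continuous fun t => W t s) {u : ℝ≥0}
    (hu : x + W u s ∉ Set.Ioo (0 : ℝ) 1) (t : ℝ≥0) :
    minExitTime W x t s = min t (minExitTime W x u s) := by
  refine eq_of_forall_ge_iff fun c => ?_
  rw [min_le_iff, minExitTime_le_iff hW, minExitTime_le_iff hW]
  refine or_congr_right ⟨.inr, ?_⟩
  rintro (h | h)
  · exact ⟨u, h, hu⟩
  · exact h

lemma absorbed_eq_of_notMem (hW : Continuous fun t => W t s) {v t : ℝ≥0} (hvt : v ≤ t)
    (h : absorbed W x v s ∉ Set.Ioo (0 : ℝ) 1) : absorbed W x t s = absorbed W x v s := by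
  rw [absorbed_mem_Ioo_iff hW] at h
  push Not at h
  obtain ⟨u, huv, hu⟩ := h
  have huv' : minExitTime W x u s ≤ v := (minExitTime_le hW u).trans huv
  rw [absorbed_eq, absorbed_eq, minExitTime_eq_min hW hu t, minExitTime_eq_min hW hu v,
    min_eq_right huv', min_eq_right (huv'.trans hvt)]

lemma absorbed_zero (hW : Continuous fun t => W t s) (x : ℝ) :
    absorbed W x 0 s = x + W 0 s := by
  rw [absorbed_eq, nonpos_iff_eq_zero.1 (minExitTime_le hW 0)]

lemma minExitTime_add (hW : Continuous fun t => W t s) {t : ℝ≥0}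
    (ht : ∀ u ≤ t, x + W u s ∈ Set.Ioo (0 : ℝ) 1) (r : ℝ≥0) :
    minExitTime W x (t + r) s =
      t + minExitTime (fun v s => W (t + v) s - W t s) (x + W t s) r s := by
  refine eq_of_forall_ge_iff fun c => ?_
  rcases lt_or_ge c t with hc | hc
  · refine iff_of_false (fun h => ?_) fun h => (le_self_add.trans h).not_gt hc
    obtain h | ⟨u, huc, hu⟩ := (minExitTime_le_iff hW).1 h
    · exact (le_self_add.trans h).not_gt hc
    · exact hu (ht u (huc.trans hc.le))
  obtain ⟨d, rfl⟩ := exists_add_of_le hc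
  rw [minExitTime_le_iff hW, add_le_add_iff_left, add_le_add_iff_left,
    minExitTime_le_iff (W := fun v s => W (t + v) s - W t s) (by fun_prop)]
  refine or_congr_right ⟨fun ⟨u, hud, hu⟩ => ?_, fun ⟨v, hvd, hv⟩ => ?_⟩
  · obtain ⟨v, rfl⟩ := exists_add_of_le (not_le.1 fun hut => hu (ht u hut)).le
    exact ⟨v, (add_le_add_iff_left t).1 hud, by simpa using hu⟩
  · exact ⟨t + v, by gcongr, by simpa using hv⟩

lemma absorbed_add (hW : Continuous fun t => W t s) (t r : ℝ≥0) :
    absorbed W x (t + r) s =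
      absorbed (fun v s => W (t + v) s - W t s) (absorbed W x t s) r s := by
  by_cases h : absorbed W x t s ∈ Set.Ioo (0 : ℝ) 1
  · have ht := (absorbed_mem_Ioo_iff hW).1 h
    rw [absorbed_of_forall_mem hW ht, absorbed_eq W, absorbed_eq, minExitTime_add hW ht]
    ring
  · have hW' : Continuous fun v => W (t + v) s - W t s := by fun_prop
    have h0 := absorbed_zero (W := fun v s => W (t + v) s - W t s) hW' (absorbed W x t s)
    simp only [add_zero, sub_self] at h0
    have hr := absorbed_eq_of_notMem (W := fun v s => W (t + v) s - W t s) hW' (zero_le (a := r))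
      (h0.symm ▸ h)
    rw [absorbed_eq_of_notMem hW le_self_add h, hr, h0]

lemma absorbed_congr {W' : ℝ≥0 → S → ℝ} (hW : Continuous fun t => W t s)
    (hW' : Continuous fun t => W' t s) {t : ℝ≥0} (h : ∀ u ≤ t, W u s = W' u s) :
    absorbed W x t s = absorbed W' x t s := by
  have : minExitTime W x t s = minExitTime W' x t s := by
    refine eq_of_forall_ge_iff fun c => ?_
    rw [minExitTime_le_iff hW, minExitTime_le_iff hW']
    rcases le_or_gt t c with hc | hc
    · exact iff_of_true (.inl hc) (.inl hc)
    · refine or_congr_right (exists_congr fun u => and_congr_right fun hu => ?_)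
      rw [h u (hu.trans hc.le)]
  rw [absorbed_eq, absorbed_eq, this, h _ (minExitTime_le hW' t)]

lemma continuous_minExitTime (hW : Continuous fun t => W t s) :
    Continuous fun t => minExitTime W x t s := by
  by_cases hex : ∃ u, x + W u s ∉ Set.Ioo (0 : ℝ) 1
  · obtain ⟨u, hu⟩ := hex
    rw [funext (minExitTime_eq_min hW hu)]
    fun_prop
  · push Not at hex
    rw [funext fun t => minExitTime_of_forall_mem hW fun u _ => hex u]
    fun_prop

lemma continuous_absorbed (hW : Continuous fun t => W t s) :
    Continuous fun t => absorbed W x t s :=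
  continuous_const.add (hW.comp (continuous_minExitTime hW))

lemma hitTime_le_iff (hW : Continuous fun t => W t s) {a : ℝ} (ha : a ∉ Set.Ioo (0 : ℝ) 1)
    (t : ℝ≥0) : hitTime W x a s ≤ (t : WithTop ℝ≥0) ↔ absorbed W x t s = a := by
  rw [hitTime, hittingAfter_le_iff_of_isClosed isClosed_singleton (continuous_absorbed hW)]
  refine ⟨fun ⟨v, hv, hva⟩ => ?_, fun h => ⟨t, ⟨zero_le, le_rfl⟩, h⟩⟩
  rw [Set.mem_singleton_iff] at hva
  rw [absorbed_eq_of_notMem hW hv.2 (hva ▸ ha), hva]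

lemma measurable_minExitTime [MeasurableSpace S] (hW : ∀ s, Continuous fun t => W t s)
    (hm : ∀ t, Measurable (W t)) :
    Measurable fun p : ℝ≥0 × ℝ × S => minExitTime W p.2.1 p.1 p.2.2 := by
  refine measurable_of_Iic fun c => ?_
  have : CompactSpace (Set.Iic c) :=
    isCompact_iff_compactSpace.1 (Set.Icc_bot (a := c) ▸ isCompact_Icc)
  have hexit : MeasurableSet {p : ℝ≥0 × ℝ × S |
      ∀ u : Set.Iic c, 0 < min (p.2.1 + W u p.2.2) (1 - (p.2.1 + W u p.2.2))} :=
    measurableSet_forall_pos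
      (fun p => by have := hW p.2.2; fun_prop) (fun u => by have := hm u; fun_prop)
  have heq : (fun p : ℝ≥0 × ℝ × S => minExitTime W p.2.1 p.1 p.2.2) ⁻¹' Set.Iic c =
      {p | p.1 ≤ c} ∪ {p : ℝ≥0 × ℝ × S |
        ∀ u : Set.Iic c, 0 < min (p.2.1 + W u p.2.2) (1 - (p.2.1 + W u p.2.2))}ᶜ := by
    ext p
    simp [minExitTime_le_iff (hW _)]
  rw [heq]
  exact (measurable_fst measurableSet_Iic).union hexit.compl

lemma measurable_absorbed [MeasurableSpace S] (hW : ∀ s, Continuous fun t => W t s)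
    (hm : ∀ t, Measurable (W t)) {A : Type*} [MeasurableSpace A] {t : A → ℝ≥0} {x : A → ℝ}
    {s : A → S} (ht : Measurable t) (hx : Measurable x) (hs : Measurable s) :
    Measurable fun a => absorbed W (x a) (t a) (s a) :=
  hx.add ((measurable_uncurry_of_continuous_of_measurable hW hm).comp
    (((measurable_minExitTime hW hm).comp (ht.prodMk (hx.prodMk hs))).prodMk hs))

end Path

/-! ### The semigroup of absorbed Brownian motion -/

lemma exists_measurable_continuous_indistinguishable {T S E : Type*} [TopologicalSpace T]
    [TopologicalSpace.SeparableSpace T] [FrechetUrysohnSpace T] [MeasurableSpace S]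
    [TopologicalSpace E] [TopologicalSpace.PseudoMetrizableSpace E] [MeasurableSpace E]
    [BorelSpace E] [Zero E] {X : T → S → E} {μ : Measure S} (hX : ∀ t, AEMeasurable (X t) μ)
    (hc : ∀ᵐ s ∂μ, Continuous (X · s)) :
    ∃ Y : T → S → E, (∀ t, Measurable (Y t)) ∧ (∀ s, Continuous (Y · s)) ∧
      ∀ᵐ s ∂μ, ∀ t, X t s = Y t s := by
  obtain ⟨D, hD, hDdense⟩ := TopologicalSpace.exists_countable_dense T
  have hgood : ∀ᵐ s ∂μ, Continuous (X · s) ∧ ∀ t ∈ D, X t s = (hX t).mk _ s :=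
    hc.and ((ae_ball_iff hD).2 fun t _ => (hX t).ae_eq_mk)
  obtain ⟨A, hAe, hA, hAg⟩ := hgood.exists_measurable_mem
  have hYc (s : S) : Continuous fun t => A.indicator (X t) s := by
    by_cases hs : s ∈ A
    · simpa only [Set.indicator_of_mem hs] using (hAg s hs).1
    · simpa only [Set.indicator_of_notMem hs] using continuous_const
  have hYD (t : T) (ht : t ∈ D) : Measurable (A.indicator (X t)) := by
    rw [Set.indicator_congr fun s hs => (hAg s hs).2 t ht]
    exact (hX t).measurable_mk.indicator hA
  refine ⟨fun t => A.indicator (X t), fun t => ?_, hYc, ?_⟩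
  · obtain ⟨u, hu, hlim⟩ := mem_closure_iff_seq_limit.1 (hDdense t)
    exact measurable_of_tendsto_metrizable (fun n => hYD (u n) (hu n))
      (tendsto_pi_nhds.2 fun s => ((hYc s).tendsto t).comp hlim)
  · filter_upwards [hAe] with s hs t
    rw [Set.indicator_of_mem hs]

/-- A Brownian motion in the strict sense: every random variable is measurable, every path is
continuous, and every path starts at `0`. -/
structure IsRegularBrownian {S : Type*} [MeasurableSpace S] (W : ℝ≥0 → S → ℝ) (Pr : Measure S) :
    Prop where
  isPreBrownian : IsPreBrownianReal W Pr
  continuous_path : ∀ s, Continuous fun t => W t s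
  measurable : ∀ t, Measurable (W t)
  zero : ∀ s, W 0 s = 0

/-- The space of continuous paths, with the σ-algebra generated by the coordinates. -/
abbrev PathSpace : Type := {w : ℝ≥0 → ℝ // Continuous w}

namespace PathSpace

/-- The coordinate process on the path space. -/
def coord (t : ℝ≥0) (w : PathSpace) : ℝ := w.1 t

lemma continuous_coord (w : PathSpace) : Continuous fun t => coord t w := w.2

lemma measurable_coord (t : ℝ≥0) : Measurable (coord t) :=
  (measurable_pi_apply t).comp measurable_subtype_coe

/-- The map sending a sample point to its path, for a process `W` with continuous paths. -/
def pathMap {S : Type*} (W : ℝ≥0 → S → ℝ) (hc : ∀ s, Continuous fun t => W t s) (s : S) :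
    PathSpace :=
  ⟨fun t => W t s, hc s⟩

lemma measurable_pathMap {S : Type*} [MeasurableSpace S] {W : ℝ≥0 → S → ℝ}
    (hc : ∀ s, Continuous fun t => W t s) (hm : ∀ t, Measurable (W t)) :
    Measurable (pathMap W hc) :=
  (measurable_pi_lambda _ hm).subtype_mk

end PathSpace

/-- The semigroup `T_t F(x) = E F(X_t)` of the absorbed Brownian motion `X` started at `x`. -/
noncomputable def semigroup {S : Type*} [MeasurableSpace S] (Pr : Measure S) (W : ℝ≥0 → S → ℝ)
    (t : ℝ≥0) (F : ℝ → ℝ≥0∞) (x : ℝ) : ℝ≥0∞ :=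
  ∫⁻ s, F (absorbed W x t s) ∂Pr

lemma exists_isRegularBrownian {S : Type*} [MeasurableSpace S] {Pr : Measure S}
    {W : ℝ≥0 → S → ℝ} (hW : IsBrownianReal W Pr) :
    ∃ W' : ℝ≥0 → S → ℝ, IsRegularBrownian W' Pr ∧ ∀ᵐ s ∂Pr, ∀ t, W t s = W' t s := by
  obtain ⟨Y, hYm, hYc, hWY⟩ :=
    exists_measurable_continuous_indistinguishable hW.aemeasurable hW.cont
  have hae : ∀ᵐ s ∂Pr, ∀ t, W t s = Y t s - Y 0 s := by
    filter_upwards [hWY, hW.eval_zero_ae_eq_zero] with s hs h0 t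
    rw [← hs, ← hs, h0, sub_zero]
  exact ⟨fun t s => Y t s - Y 0 s,
    { isPreBrownian := hW.toIsPreBrownianReal.congr fun t => hae.mono fun s hs => hs t
      continuous_path := fun s => (hYc s).sub continuous_const
      measurable := fun t => (hYm t).sub (hYm 0)
      zero := fun s => sub_self _ }, hae⟩

namespace IsRegularBrownian

open PathSpace

variable {S : Type*} [MeasurableSpace S] {Pr : Measure S} {W : ℝ≥0 → S → ℝ}

lemma isProbabilityMeasure (hW : IsRegularBrownian W Pr) : IsProbabilityMeasure Pr :=
  hW.isPreBrownian.isGaussianProcess.isProbabilityMeasure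

lemma isProjectiveLimit (hW : IsRegularBrownian W Pr) :
    IsProjectiveLimit (Pr.map fun s t => W t s) BrownianReal.projectiveFamily := fun I =>
  (isProjectiveLimit_map (measurable_pi_lambda _ hW.measurable).aemeasurable I).trans
    (hW.isPreBrownian.hasLaw I).map_eq

lemma map_pathMap_eq {S' : Type*} [MeasurableSpace S'] {Pr' : Measure S'} {V : ℝ≥0 → S' → ℝ}
    (hV : IsRegularBrownian V Pr') (hW : IsRegularBrownian W Pr) :
    Pr'.map (pathMap V hV.continuous_path) = Pr.map (pathMap W hW.continuous_path) := by
  have hmap := hV.isProjectiveLimit.unique hW.isProjectiveLimit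
  ext _ ⟨B, hB, rfl⟩
  rw [Measure.map_apply (measurable_pathMap _ hV.measurable) (measurable_subtype_coe hB),
    Measure.map_apply (measurable_pathMap _ hW.measurable) (measurable_subtype_coe hB)]
  have := congrArg (· B) hmap
  rwa [Measure.map_apply (measurable_pi_lambda _ hV.measurable) hB,
    Measure.map_apply (measurable_pi_lambda _ hW.measurable) hB] at this

lemma lintegral_map_pathMap (hW : IsRegularBrownian W Pr) {F : ℝ → ℝ≥0∞} (hF : Measurable F)
    (t : ℝ≥0) (x : ℝ) :
    ∫⁻ w, F (absorbed coord x t w) ∂Pr.map (pathMap W hW.continuous_path) =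
      semigroup Pr W t F x :=
  lintegral_map (hF.comp (measurable_absorbed continuous_coord measurable_coord
    measurable_const measurable_const measurable_id)) (measurable_pathMap _ hW.measurable)

lemma semigroup_eq {S' : Type*} [MeasurableSpace S'] {Pr' : Measure S'} {V : ℝ≥0 → S' → ℝ}
    (hV : IsRegularBrownian V Pr') (hW : IsRegularBrownian W Pr) {F : ℝ → ℝ≥0∞}
    (hF : Measurable F) (t : ℝ≥0) : semigroup Pr' V t F = semigroup Pr W t F := by
  ext x
  rw [← hV.lintegral_map_pathMap hF, ← hW.lintegral_map_pathMap hF, hV.map_pathMap_eq hW]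

lemma shift (hW : IsRegularBrownian W Pr) (t : ℝ≥0) :
    IsRegularBrownian (fun v s => W (t + v) s - W t s) Pr where
  isPreBrownian := hW.isPreBrownian.shift t
  continuous_path s := by have := hW.continuous_path s; fun_prop
  measurable v := (hW.measurable _).sub (hW.measurable _)
  zero s := by simp

lemma measurable_absorbed_const (hW : IsRegularBrownian W Pr) (x : ℝ) (t : ℝ≥0) :
    Measurable (absorbed W x t) :=
  measurable_absorbed hW.continuous_path hW.measurable measurable_const measurable_const
    measurable_id

lemma measurable_semigroup (hW : IsRegularBrownian W Pr) {F : ℝ → ℝ≥0∞} (hF : Measurable F) :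
    Measurable fun p : ℝ≥0 × ℝ => semigroup Pr W p.1 F p.2 := by
  have := hW.isProbabilityMeasure
  exact Measurable.lintegral_prod_right' (f := fun q : (ℝ≥0 × ℝ) × S =>
    F (absorbed W q.1.2 q.1.1 q.2))
    (hF.comp (measurable_absorbed hW.continuous_path hW.measurable measurable_fst.fst
      measurable_fst.snd measurable_snd))

lemma measurable_semigroup_right (hW : IsRegularBrownian W Pr) {F : ℝ → ℝ≥0∞} (hF : Measurable F)
    (t : ℝ≥0) : Measurable (semigroup Pr W t F) :=
  (hW.measurable_semigroup hF).comp measurable_prodMk_left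

/-- The σ-algebra generated by the path up to time `t`. -/
abbrev past {S : Type*} (W : ℝ≥0 → S → ℝ) (t : ℝ≥0) : MeasurableSpace S :=
  MeasurableSpace.comap (fun s (u : Set.Iic t) => W u s) inferInstance

-- Stopping the driving path at `t` does not change `absorbed W x t`.
lemma measurable_absorbed_past (hW : IsRegularBrownian W Pr) (x : ℝ) (t : ℝ≥0) :
    Measurable[past W t] (absorbed W x t) := by
  have hc (s : S) : Continuous fun u => W (min u t) s := by
    have := hW.continuous_path s
    fun_prop
  have hm (u : ℝ≥0) : Measurable[past W t] (W (min u t)) :=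
    (measurable_pi_apply (⟨min u t, min_le_right u t⟩ : Set.Iic t)).comp
      (comap_measurable fun s (u : Set.Iic t) => W u s)
  have h : absorbed W x t = fun s => absorbed (fun u s => W (min u t) s) x t s := by
    ext s
    exact absorbed_congr (hW.continuous_path s) (hc s) fun u hu => by rw [min_eq_left hu]
  rw [h]
  let _ := past W t
  exact measurable_absorbed hc hm measurable_const measurable_const measurable_id

lemma indepFun_absorbed_pathMap_shift (hW : IsRegularBrownian W Pr) (x : ℝ) (t : ℝ≥0) :
    IndepFun (absorbed W x t) (pathMap _ (hW.shift t).continuous_path) Pr := by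
  refine (indep_of_indep_of_le_left (indep_of_indep_of_le_right
    (hW.isPreBrownian.indepFun_shift t) (hW.measurable_absorbed_past x t).comap_le) ?_).symm
  let _ := MeasurableSpace.comap (fun s (v : ℝ≥0) => W (t + v) s - W t s) inferInstance
  exact (measurable_pathMap _ fun v =>
    (measurable_pi_apply v).comp
      (comap_measurable fun s (v : ℝ≥0) => W (t + v) s - W t s)).comap_le

-- Markov property: after time `t` the path restarts from `X_t`, independently of the past.
lemma semigroup_add (hW : IsRegularBrownian W Pr) {F : ℝ → ℝ≥0∞} (hF : Measurable F)
    (t r : ℝ≥0) (x : ℝ) :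
    semigroup Pr W (t + r) F x = semigroup Pr W t (semigroup Pr W r F) x := by
  have := hW.isProbabilityMeasure
  set γ := pathMap _ (hW.shift t).continuous_path
  have hX := hW.measurable_absorbed_const x t
  have hγ : Measurable γ := measurable_pathMap _ (hW.shift t).measurable
  have hG : Measurable fun p : ℝ × PathSpace => F (absorbed coord p.1 r p.2) :=
    hF.comp (measurable_absorbed continuous_coord measurable_coord measurable_const
      measurable_fst measurable_snd)
  calc semigroup Pr W (t + r) F x
      = ∫⁻ s, F (absorbed coord (absorbed W x t s) r (γ s)) ∂Pr :=
        lintegral_congr fun s => by rw [absorbed_add (hW.continuous_path s)]; rfl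
    _ = ∫⁻ p, F (absorbed coord p.1 r p.2) ∂Pr.map fun s => (absorbed W x t s, γ s) :=
        (lintegral_map hG (hX.prodMk hγ)).symm
    _ = ∫⁻ y, ∫⁻ w, F (absorbed coord y r w) ∂Pr.map γ ∂Pr.map (absorbed W x t) := by
        rw [(indepFun_iff_map_prod_eq_prod_map_map hX.aemeasurable hγ.aemeasurable).1
          (hW.indepFun_absorbed_pathMap_shift x t), lintegral_prod _ hG.aemeasurable]
    _ = ∫⁻ y, semigroup Pr W r F y ∂Pr.map (absorbed W x t) :=
        lintegral_congr fun y => by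
          rw [(hW.shift t).lintegral_map_pathMap hF, (hW.shift t).semigroup_eq hW hF]
    _ = semigroup Pr W t (semigroup Pr W r F) x :=
        lintegral_map (hW.measurable_semigroup_right hF r) hX

/-! ### Time reversal and symmetry of the semigroup -/

/-- The time reversal `r ↦ W (t - r) - W t` of `W` at time `t`. It is continued after time `t` by
the increments of `W` so as to be defined, and a Brownian motion, at all times. -/
def reversal (W : ℝ≥0 → S → ℝ) (t r : ℝ≥0) (s : S) : ℝ :=
  W (t - r) s - W t s + (W (max r t) s - W t s)

lemma isGaussianProcess_reversal (hW : IsRegularBrownian W Pr) (t : ℝ≥0) :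
    IsGaussianProcess (reversal W t) Pr :=
  hW.isPreBrownian.isGaussianProcess.of_isGaussianProcess fun r => ⟨{t - r, t, max r t},
    { toFun x := x ⟨t - r, by simp⟩ - x ⟨t, by simp⟩ + (x ⟨max r t, by simp⟩ - x ⟨t, by simp⟩)
      map_add' x y := by simp; abel
      map_smul' c x := by simp; ring }, fun _ => rfl⟩

lemma covariance_reversal (hW : IsRegularBrownian W Pr) (t : ℝ≥0) {q r : ℝ≥0} (hqr : q ≤ r) :
    cov[reversal W t q, reversal W t r; Pr] = q := by
  have := hW.isProbabilityMeasure
  have hB := hW.isPreBrownian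
  have hL2 (u : ℝ≥0) : MemLp (W u) 2 Pr := (hB.isGaussianProcess.hasGaussianLaw_eval u).memLp_two
  have hd (u v : ℝ≥0) : MemLp (W u - W v) 2 Pr := (hL2 u).sub (hL2 v)
  have hcov (a b : ℝ≥0) : cov[W a, W b; Pr] = min (a : ℝ) b := by
    rw [hB.covariance_eval, NNReal.coe_min]
  have hrev (r : ℝ≥0) : reversal W t r = (W (t - r) - W t) + (W (max r t) - W t) := rfl
  rw [hrev, hrev, covariance_add_left (hd _ _) (hd _ _) ((hd _ _).add (hd _ _)),
    covariance_add_right (hd _ _) (hd _ _) (hd _ _),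
    covariance_add_right (hd _ _) (hd _ _) (hd _ _)]
  simp only [covariance_sub_left (hL2 _) (hL2 _) (hd _ _),
    covariance_sub_right (hL2 _) (hL2 _) (hL2 _), hcov]
  have hqr' : (q : ℝ) ≤ r := hqr
  have hq0 := q.coe_nonneg
  have ht0 := t.coe_nonneg
  rw [NNReal.coe_sub_def, NNReal.coe_sub_def, NNReal.coe_max, NNReal.coe_max]
  grind

lemma isRegularBrownian_reversal (hW : IsRegularBrownian W Pr) (t : ℝ≥0) :
    IsRegularBrownian (reversal W t) Pr where
  continuous_path s := by
    have := hW.continuous_path s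
    unfold reversal
    fun_prop
  measurable r := ((hW.measurable _).sub (hW.measurable _)).add
    ((hW.measurable _).sub (hW.measurable _))
  zero s := by simp [reversal]
  isPreBrownian := by
    refine (hW.isGaussianProcess_reversal t).isPreBrownianReal_of_covariance (fun r => ?_)
      fun q r hqr => hW.covariance_reversal t hqr
    have hB := hW.isPreBrownian
    have hi (u v : ℝ≥0) : Integrable (fun s => W u s - W v s) Pr :=
      (hB.integrable_eval u).sub (hB.integrable_eval v)
    have hz (u v : ℝ≥0) : ∫ s, W u s - W v s ∂Pr = 0 := by
      rw [integral_sub (hB.integrable_eval u) (hB.integrable_eval v), hB.integral_eval,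
        hB.integral_eval, sub_zero]
    exact (integral_add (hi _ _) (hi _ _)).trans (by rw [hz, hz, add_zero])

-- Up to time `t`, `reversal W t` started at `x + W t` runs through the path `x + W` backwards.
lemma forall_mem_reversal_iff {S : Type*} {W : ℝ≥0 → S → ℝ} (x : ℝ) (t : ℝ≥0) (s : S) (A : Set ℝ) :
    (∀ u ≤ t, x + W t s + reversal W t u s ∈ A) ↔ ∀ u ≤ t, x + W u s ∈ A := by
  have hrev (u : ℝ≥0) (hu : u ≤ t) : x + W t s + reversal W t u s = x + W (t - u) s := by
    rw [reversal, max_eq_right hu]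
    ring
  refine ⟨fun h u hu => ?_, fun h u hu => hrev u hu ▸ h _ tsub_le_self⟩
  have := h (t - u) tsub_le_self
  rwa [hrev _ tsub_le_self, tsub_tsub_cancel_of_le hu] at this

lemma zeroExt_mul_absorbed (hW : IsRegularBrownian W Pr) (f g : I01 → ℝ≥0∞) (t : ℝ≥0) (s : S)
    (x : ℝ) :
    zeroExt f x * zeroExt g (absorbed W x t s) =
      zeroExt g (x + W t s) * zeroExt f (absorbed (reversal W t) (x + W t s) t s) := by
  have hc := hW.continuous_path s
  have hc' := (hW.isRegularBrownian_reversal t).continuous_path s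
  have hiff := forall_mem_reversal_iff (W := W) x t s (Set.Ioo 0 1)
  by_cases h : ∀ u ≤ t, x + W u s ∈ Set.Ioo (0 : ℝ) 1
  · rw [absorbed_of_forall_mem hc h, absorbed_of_forall_mem hc' (hiff.2 h), mul_comm]
    simp [reversal, hW.zero]
  · rw [zeroExt_of_notMem g ((absorbed_mem_Ioo_iff hc).not.2 h),
      zeroExt_of_notMem f ((absorbed_mem_Ioo_iff hc').not.2 (hiff.not.2 h)), mul_zero, mul_zero]

lemma lintegral_mul_semigroup (hW : IsRegularBrownian W Pr) {F G : ℝ → ℝ≥0∞} (hF : Measurable F)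
    (hG : Measurable G) (μ : Measure ℝ) [SFinite μ] (t : ℝ≥0) :
    ∫⁻ x, F x * semigroup Pr W t G x ∂μ =
      ∫⁻ s, ∫⁻ x, F x * G (absorbed W x t s) ∂μ ∂Pr := by
  have := hW.isProbabilityMeasure
  have hX : Measurable fun p : ℝ × S => absorbed W p.1 t p.2 :=
    measurable_absorbed hW.continuous_path hW.measurable measurable_const measurable_fst
      measurable_snd
  rw [← lintegral_lintegral_swap ((hF.comp measurable_fst).mul (hG.comp hX)).aemeasurable]
  exact lintegral_congr fun x =>
    (lintegral_const_mul _ (hG.comp (hW.measurable_absorbed_const x t))).symm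

lemma lintegral_mul_semigroup_comm (hW : IsRegularBrownian W Pr) {f g : I01 → ℝ≥0∞}
    (hf : Measurable f) (hg : Measurable g) (t : ℝ≥0) :
    ∫⁻ x, zeroExt f x * semigroup Pr W t (zeroExt g) x =
      ∫⁻ x, zeroExt g x * semigroup Pr W t (zeroExt f) x := by
  have hf' := measurable_zeroExt hf
  have hg' := measurable_zeroExt hg
  have hV := hW.isRegularBrownian_reversal t
  calc ∫⁻ x, zeroExt f x * semigroup Pr W t (zeroExt g) x
      = ∫⁻ s, (∫⁻ x : ℝ, zeroExt g (x + W t s) *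
          zeroExt f (absorbed (reversal W t) (x + W t s) t s)) ∂Pr := by
        simp_rw [hW.lintegral_mul_semigroup hf' hg', hW.zeroExt_mul_absorbed f g t]
    _ = ∫⁻ s, (∫⁻ y, zeroExt g y * zeroExt f (absorbed (reversal W t) y t s)) ∂Pr :=
        lintegral_congr fun s => lintegral_add_right_eq_self
          (fun y => zeroExt g y * zeroExt f (absorbed (reversal W t) y t s)) _
    _ = ∫⁻ x, zeroExt g x * semigroup Pr W t (zeroExt f) x := by
        rw [← hV.lintegral_mul_semigroup hg' hf', hV.semigroup_eq hW hf']

end IsRegularBrownian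

/-! ### Optional stopping -/

section OptionalStopping

/-- The least multiple of `1 / (n + 1)` that is at least `r`. -/
noncomputable def gridCeil (n : ℕ) (r : ℝ≥0) : ℝ≥0 := ⌈(n + 1) * r⌉₊ / (n + 1)

lemma le_gridCeil (n : ℕ) (r : ℝ≥0) : r ≤ gridCeil n r := by
  rw [gridCeil, le_div_iff₀' (by positivity)]
  exact Nat.le_ceil _

lemma gridCeil_le_add (n : ℕ) (r : ℝ≥0) : gridCeil n r ≤ r + 1 / (n + 1) := by
  rw [gridCeil, div_le_iff₀' (by positivity), mul_add, mul_one_div_cancel (by positivity)]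
  exact (Nat.ceil_lt_add_one (by positivity)).le

lemma gridCeil_le_iff (n : ℕ) (r c : ℝ≥0) :
    gridCeil n r ≤ c ↔ r ≤ ⌊(n + 1) * c⌋₊ / (n + 1) := by
  rw [gridCeil, div_le_iff₀' (by positivity), le_div_iff₀' (by positivity), ← Nat.ceil_le,
    Nat.le_floor_iff (by positivity)]

lemma tendsto_gridCeil (r : ℝ≥0) : Tendsto (gridCeil · r) atTop (𝓝 r) := by
  refine tendsto_of_tendsto_of_tendsto_of_le_of_le tendsto_const_nhds ?_
    (fun n => le_gridCeil n r) fun n => gridCeil_le_add n r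
  simpa using tendsto_const_nhds.add (tendsto_one_div_add_atTop_nhds_zero_nat (𝕜 := ℝ≥0))

variable {S : Type*} {mS : MeasurableSpace S} {μ : Measure S} {ℱ : Filtration ℝ≥0 mS}
  {τ : S → ℝ≥0}

lemma isStoppingTime_min_gridCeil (hτ : IsStoppingTime ℱ fun s => (τ s : WithTop ℝ≥0)) (n : ℕ)
    (t : ℝ≥0) :
    IsStoppingTime ℱ fun s => ((min (gridCeil n (τ s)) t : ℝ≥0) : WithTop ℝ≥0) := by
  intro c
  have hle : (⌊(n + 1) * c⌋₊ / (n + 1) : ℝ≥0) ≤ c := by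
    rw [div_le_iff₀' (by positivity)]
    exact Nat.floor_le (by positivity)
  simp only [WithTop.coe_le_coe, min_le_iff, gridCeil_le_iff]
  refine .union (ℱ.mono hle _ ?_) (.const _)
  have := hτ (⌊(n + 1) * c⌋₊ / (n + 1))
  simp only [WithTop.coe_le_coe] at this
  exact this

lemma countable_range_min_gridCeil (τ : S → ℝ≥0) (n : ℕ) (t : ℝ≥0) :
    (Set.range fun s => ((min (gridCeil n (τ s)) t : ℝ≥0) : WithTop ℝ≥0)).Countable :=
  (Set.countable_range fun k : ℕ => ((min (k / (n + 1)) t : ℝ≥0) : WithTop ℝ≥0)).mono <| by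
    rintro _ ⟨s, rfl⟩
    exact ⟨⌈(n + 1) * τ s⌉₊, rfl⟩

/- The optional sampling theorem holds for the discretizations of `τ` from above, at which `M` is
uniformly integrable since its values are conditional expectations of `M t`. -/
lemma integral_eval_stoppingTime [IsFiniteMeasure μ] {M : ℝ≥0 → S → ℝ} (hM : Martingale M ℱ μ)
    (hc : ∀ s u, ContinuousWithinAt (M · s) (Set.Ici u) u)
    (hτ : IsStoppingTime ℱ fun s => (τ s : WithTop ℝ≥0)) {t : ℝ≥0} (hle : ∀ s, τ s ≤ t) :
    ∫ s, M (τ s) s ∂μ = ∫ s, M t s ∂μ := by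
  have hρ (n : ℕ) := isStoppingTime_min_gridCeil hτ n t
  let F (n : ℕ) (s : S) : ℝ := M (min (gridCeil n (τ s)) t) s
  have hF (n : ℕ) : F n =ᵐ[μ] μ[M t | (hρ n).measurableSpace] :=
    hM.stoppedValue_ae_eq_condExp_of_le_const_of_countable_range (hρ n)
      (fun s => WithTop.coe_le_coe.2 (min_le_right _ _)) (countable_range_min_gridCeil τ n t)
  have hUI : UniformIntegrable F 1 μ :=
    ((hM.integrable t).uniformIntegrable_condExp
      fun n => (hρ n).measurableSpace_le).ae_eq fun n => (hF n).symm
  have hlim (s : S) : Tendsto (F · s) atTop (𝓝 (M (τ s) s)) := by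
    refine (hc s (τ s)).tendsto.comp (tendsto_nhdsWithin_iff.2 ⟨?_, .of_forall fun n =>
      le_min (le_gridCeil n _) (hle s)⟩)
    simpa only [min_eq_left (hle s)] using
      (tendsto_gridCeil (τ s)).min (tendsto_const_nhds (x := t))
  have hint (n : ℕ) : Integrable (F n) μ := memLp_one_iff_integrable.1 (hUI.memLp n)
  have hmem : MemLp (fun s => M (τ s) s) 1 μ :=
    hUI.memLp_of_ae_tendsto (ae_of_all _ hlim)
  refine tendsto_nhds_unique (tendsto_integral_of_L1' _ hmem.1 (.of_forall hint)
    (tendsto_Lp_finite_of_tendsto_ae le_rfl ENNReal.one_ne_top (fun n => (hint n).1) hmem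
      hUI.2.1 (ae_of_all _ hlim))) ?_
  simp_rw [integral_congr_ae (hF _), integral_condExp (hρ _).measurableSpace_le]
  exact tendsto_const_nhds

end OptionalStopping

namespace IsRegularBrownian

variable {S : Type*} [MeasurableSpace S] {Pr : Measure S} {W : ℝ≥0 → S → ℝ}

/-- The filtration generated by a Brownian motion. -/
def filtration (hW : IsRegularBrownian W Pr) : Filtration ℝ≥0 ‹MeasurableSpace S› where
  seq := past W
  mono' u v huv := by
    let _ := past W v
    exact Measurable.comap_le (measurable_pi_lambda _ fun r =>
      (measurable_pi_apply (⟨r, r.2.trans huv⟩ : Set.Iic v)).comp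
        (comap_measurable fun s (u : Set.Iic v) => W u s))
  le' u := Measurable.comap_le (measurable_pi_lambda _ fun r => hW.measurable r)

lemma martingale (hW : IsRegularBrownian W Pr) : Martingale W hW.filtration Pr := by
  have := hW.isProbabilityMeasure
  have hB := hW.isPreBrownian
  have hadapted (u : ℝ≥0) : StronglyMeasurable[hW.filtration u] (W u) :=
    ((measurable_pi_apply (⟨u, Set.self_mem_Iic⟩ : Set.Iic u)).comp
      (comap_measurable fun s (r : Set.Iic u) => W r s)).stronglyMeasurable
  refine ⟨hadapted, fun u t hut => ?_⟩
  obtain ⟨v, rfl⟩ := exists_add_of_le hut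
  have hindep : Indep (MeasurableSpace.comap (fun s (v : ℝ≥0) => W (u + v) s - W u s)
    inferInstance) (past W u) Pr := hB.indepFun_shift u
  have hincr : Pr[W (u + v) - W u | past W u] =ᵐ[Pr] 0 := by
    refine (condExp_indep_eq (Measurable.comap_le (measurable_pi_lambda _ (hW.shift u).measurable))
      (hW.filtration.le u) ((measurable_pi_apply v).comp
        (comap_measurable fun s (v : ℝ≥0) => W (u + v) s - W u s)).stronglyMeasurable hindep).trans
      (ae_of_all _ fun _ => ?_)
    exact (hB.shift u).integral_eval v
  have hsub := condExp_sub (hB.integrable_eval (u + v)) (hB.integrable_eval u) (past W u)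
  have hself : Pr[W u | past W u] = W u :=
    condExp_of_stronglyMeasurable (hW.filtration.le u) (hadapted u) (hB.integrable_eval u)
  rw [hself] at hsub
  filter_upwards [hincr, hsub] with s h1 h2
  exact sub_eq_zero.1 (h2.symm.trans h1)

lemma isStoppingTime_minExitTime (hW : IsRegularBrownian W Pr) (x : ℝ) (t : ℝ≥0) :
    IsStoppingTime hW.filtration fun s => (minExitTime W x t s : WithTop ℝ≥0) := by
  intro c
  have h : {s | (minExitTime W x t s : WithTop ℝ≥0) ≤ c} =
      {_s | t ≤ c} ∪ absorbed W x c ⁻¹' (Set.Ioo 0 1)ᶜ := by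
    ext s
    rw [Set.mem_union, Set.mem_preimage, Set.mem_compl_iff,
      absorbed_mem_Ioo_iff (hW.continuous_path s)]
    push Not
    exact WithTop.coe_le_coe.trans (minExitTime_le_iff (hW.continuous_path s))
  rw [h]
  exact .union (.const _) (hW.measurable_absorbed_past x c measurableSet_Ioo.compl)

lemma integral_absorbed (hW : IsRegularBrownian W Pr) (x : ℝ) (t : ℝ≥0) :
    ∫ s, absorbed W x t s ∂Pr = x := by
  have := hW.isProbabilityMeasure
  have hB := hW.isPreBrownian
  calc ∫ s, absorbed W x t s ∂Pr
      = ∫ s, x + W t s ∂Pr :=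
        integral_eval_stoppingTime ((martingale_const hW.filtration Pr x).add hW.martingale)
          (fun s _ => (continuous_const.add (hW.continuous_path s)).continuousWithinAt)
          (hW.isStoppingTime_minExitTime x t) fun s => minExitTime_le (hW.continuous_path s) t
    _ = x := by
        rw [integral_add (integrable_const x) (hB.integrable_eval t), hB.integral_eval]
        simp

lemma zeroExt_ofReal_m {y : ℝ} (hy : y ∈ Set.Icc (0 : ℝ) 1) :
    zeroExt (fun x => ENNReal.ofReal (m x)) y = ENNReal.ofReal (y - y ^ 2) := by
  by_cases h : y ∈ Set.Ioo (0 : ℝ) 1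
  · exact (zeroExt_coe _ ⟨y, h⟩).trans (by rw [m, mul_one_sub, sq])
  · rw [zeroExt_of_notMem _ h]
    rcases hy.1.eq_or_lt with rfl | h0
    · simp
    · obtain rfl : y = 1 := hy.2.antisymm (not_lt.1 fun h1 => h ⟨h0, h1⟩)
      simp

-- Jensen's inequality for the concave function `m`, as the absorbed path has constant expectation.
lemma semigroup_m_le (hW : IsRegularBrownian W Pr) (x : I01) (t : ℝ≥0) :
    semigroup Pr W t (zeroExt fun y => ENNReal.ofReal (m y)) x ≤ ENNReal.ofReal (m x) := by
  have := hW.isProbabilityMeasure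
  set X : S → ℝ := absorbed W x t
  have hX (s : S) : X s ∈ Set.Icc (0 : ℝ) 1 :=
    absorbed_mem_Icc (hW.continuous_path s) (hW.zero s) (Set.Ioo_subset_Icc_self x.2) t
  have hXm : MemLp X 2 Pr := .of_bound (hW.measurable_absorbed_const x t).aestronglyMeasurable 1
    (ae_of_all _ fun s => by rw [Real.norm_of_nonneg (hX s).1]; exact (hX s).2)
  have hX1 : Integrable X Pr := hXm.integrable one_le_two
  have hEX : ∫ s, X s ∂Pr = x := hW.integral_absorbed x t
  calc semigroup Pr W t (zeroExt fun y => ENNReal.ofReal (m y)) x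
      = ∫⁻ s, ENNReal.ofReal (X s - X s ^ 2) ∂Pr := lintegral_congr fun s => zeroExt_ofReal_m (hX s)
    _ = ENNReal.ofReal (∫ s, X s - X s ^ 2 ∂Pr) :=
        (ofReal_integral_eq_lintegral_ofReal (hX1.sub hXm.integrable_sq)
          (ae_of_all _ fun s => sub_nonneg.2 (pow_le_of_le_one (hX s).1 (hX s).2 two_ne_zero))).symm
    _ ≤ ENNReal.ofReal (m x) := ENNReal.ofReal_le_ofReal ?_
  have hvar := variance_nonneg X Pr
  rw [variance_eq_sub hXm, hEX] at hvar
  rw [integral_sub hX1 hXm.integrable_sq, hEX, m]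
  simp only [Pi.pow_apply] at hvar
  linarith

end IsRegularBrownian

/-! ### The law of independent absorbed Brownian motions -/

section InfiniteProduct

variable {ι : Type*} {S : ι → Type*} [∀ i, MeasurableSpace (S i)] (P : ∀ i, Measure (S i))
  [∀ i, IsProbabilityMeasure (P i)] {f : ∀ i, S i → ℝ≥0∞}

lemma lintegral_eval_infinitePi {i : ι} {f : S i → ℝ≥0∞} (hf : Measurable f) :
    ∫⁻ w, f (w i) ∂Measure.infinitePi P = ∫⁻ s, f s ∂P i :=
  (measurePreserving_eval_infinitePi P i).lintegral_comp hf

lemma lintegral_prod_infinitePi (hf : ∀ i, Measurable (f i)) (F : Finset ι) :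
    ∫⁻ w, ∏ i ∈ F, f i (w i) ∂Measure.infinitePi P = ∏ i ∈ F, ∫⁻ s, f i s ∂P i := by
  rw [lintegral_prod_eq_prod_lintegral_of_indepFun F (fun i (w : ∀ i, S i) => f i (w i))
    (iIndepFun_infinitePi (P := P) hf) fun i => (hf i).comp (measurable_pi_apply i)]
  exact Finset.prod_congr rfl fun i _ => lintegral_eval_infinitePi P (hf i)

lemma lintegral_expNeg_tsum_infinitePi [Countable ι] (hf : ∀ i, Measurable (f i)) :
    ∫⁻ w, expNeg (∑' i, f i (w i)) ∂Measure.infinitePi P =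
      expNeg (∑' i, negLog (∫⁻ s, expNeg (f i s) ∂P i)) := by
  have hY (i : ι) : Measurable fun s => expNeg (f i s) := measurable_expNeg.comp (hf i)
  have hprod (F : Finset ι) : ∫⁻ w, ∏ i ∈ F, expNeg (f i (w i)) ∂Measure.infinitePi P =
      ∏ i ∈ F, expNeg (negLog (∫⁻ s, expNeg (f i s) ∂P i)) := by
    rw [lintegral_prod_infinitePi P hY F]
    refine Finset.prod_congr rfl fun i _ => (expNeg_negLog ?_).symm
    exact (lintegral_mono fun _ => expNeg_le_one _).trans (by simp)
  have hlim : Tendsto (fun F : Finset ι => ∫⁻ w, ∏ i ∈ F, expNeg (f i (w i)) ∂Measure.infinitePi P)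
      atTop (𝓝 (∫⁻ w, expNeg (∑' i, f i (w i)) ∂Measure.infinitePi P)) :=
    tendsto_lintegral_filter_of_dominated_convergence (fun _ => 1)
      (.of_forall fun F => Finset.measurable_fun_prod F fun i _ =>
        (hY i).comp (measurable_pi_apply i))
      (.of_forall fun F => ae_of_all _ fun w => Finset.prod_le_one' fun i _ => expNeg_le_one _)
      (by simp) (ae_of_all _ fun w => tendsto_prod_expNeg _)
  simp_rw [hprod] at hlim
  exact tendsto_nhds_unique hlim (tendsto_prod_expNeg _)

end InfiniteProduct

section FreeLaw

open BrownianGas.Configuration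

variable {S : Type*} [MeasurableSpace S] {Pr : Measure S} {W : ℝ≥0 → S → ℝ}

/-- The nonlinear evolution `V_t g(x) = -log E e^{-g(X_t)}`, with `X` the absorbed Brownian motion
started at `x` and `g` extended by zero outside `(0,1)`. -/
noncomputable def evolve (Pr : Measure S) (W : ℝ≥0 → S → ℝ) (t : ℝ≥0) (g : I01 → ℝ≥0∞) (x : I01) :
    ℝ≥0∞ :=
  negLog (semigroup Pr W t (fun y => expNeg (zeroExt g y)) x)

lemma expNeg_evolve [IsProbabilityMeasure Pr] (t : ℝ≥0) (g : I01 → ℝ≥0∞) (x : I01) :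
    expNeg (evolve Pr W t g x) = semigroup Pr W t (fun y => expNeg (zeroExt g y)) x :=
  expNeg_negLog ((lintegral_mono fun _ => expNeg_le_one _).trans (by simp))

namespace IsRegularBrownian

lemma measurable_evolve (hW : IsRegularBrownian W Pr) {g : I01 → ℝ≥0∞} (hg : Measurable g) :
    Measurable fun p : ℝ≥0 × I01 => evolve Pr W p.1 g p.2 :=
  measurable_negLog.comp <|
    (hW.measurable_semigroup (measurable_expNeg.comp (measurable_zeroExt hg))).comp
      (measurable_fst.prodMk (measurable_subtype_coe.comp measurable_snd))

lemma measurable_evolve_right (hW : IsRegularBrownian W Pr) {g : I01 → ℝ≥0∞} (hg : Measurable g)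
    (t : ℝ≥0) : Measurable (evolve Pr W t g) :=
  (hW.measurable_evolve hg).comp measurable_prodMk_left

lemma measurable_absorbed_eval (hW : IsRegularBrownian W Pr) (t : ℝ≥0) {ω : Configuration}
    (p : ω.Particle) : Measurable fun w : ω.Particle → S => absorbed W p.pos t (w p) :=
  (hW.measurable_absorbed_const p.pos t).comp (measurable_pi_apply p)

lemma ae_totalWeight_lt_top (hW : IsRegularBrownian W Pr) [IsProbabilityMeasure Pr] (t : ℝ≥0)
    (ω : Configuration) :
    ∀ᵐ w ∂Measure.infinitePi fun _ : ω.Particle => Pr,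
      totalWeight (fun p : ω.Particle => absorbed W p.pos t (w p)) < ∞ := by
  have hm := measurable_zeroExt measurable_ofReal_m
  have hmeas (p : ω.Particle) := hm.comp (hW.measurable_absorbed_eval t p)
  refine ae_lt_top (.tsum hmeas) (ne_of_lt ?_)
  calc ∫⁻ w, totalWeight (fun p : ω.Particle => absorbed W p.pos t (w p))
        ∂Measure.infinitePi (fun _ => Pr)
      = ∑' p : ω.Particle, semigroup Pr W t (zeroExt fun y => ENNReal.ofReal (m y)) p.pos := by
        refine (lintegral_tsum fun p => (hmeas p).aemeasurable).trans (tsum_congr fun p => ?_)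
        exact lintegral_eval_infinitePi _ (hm.comp (hW.measurable_absorbed_const p.pos t))
    _ ≤ ∑' p : ω.Particle, ENNReal.ofReal (m p.1) :=
        ENNReal.tsum_le_tsum fun p => hW.semigroup_m_le p.1 t
    _ = ∫⁻ x, ENNReal.ofReal (m x) ∂ω.toMeasure :=
        (ω.lintegral_eq_tsum_particle fun x => ENNReal.ofReal (m x)).symm
    _ < ∞ := ω.isConfiguration.tempered

lemma measurable_ofPoints_absorbed (hW : IsRegularBrownian W Pr) (t : ℝ≥0) (ω : Configuration) :
    Measurable fun w : ω.Particle → S =>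
      ofPoints fun p : ω.Particle => absorbed W p.pos t (w p) :=
  measurable_ofPoints (hW.measurable_absorbed_eval t)

lemma isProbabilityMeasure_freeLaw (hW : IsRegularBrownian W Pr) (t : ℝ≥0) (ω : Configuration) :
    IsProbabilityMeasure (freeLaw Pr W t ω) := by
  have := hW.isProbabilityMeasure
  exact Measure.isProbabilityMeasure_map (hW.measurable_ofPoints_absorbed t ω).aemeasurable

lemma lintegral_laplaceVar_freeLaw (hW : IsRegularBrownian W Pr) (t : ℝ≥0) (ω : Configuration)
    {g : I01 → ℝ≥0∞} (hg : Measurable g) :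
    ∫⁻ η, laplaceVar g η ∂freeLaw Pr W t ω = laplaceVar (evolve Pr W t g) ω := by
  have := hW.isProbabilityMeasure
  calc ∫⁻ η, laplaceVar g η ∂freeLaw Pr W t ω
      = ∫⁻ w, laplaceVar g (ofPoints fun p : ω.Particle => absorbed W p.pos t (w p))
          ∂Measure.infinitePi (fun _ => Pr) :=
        lintegral_map (measurable_laplaceVar hg) (hW.measurable_ofPoints_absorbed t ω)
    _ = ∫⁻ w, expNeg (∑' p : ω.Particle, zeroExt g (absorbed W p.pos t (w p)))
          ∂Measure.infinitePi (fun _ => Pr) :=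
        lintegral_congr_ae <| (hW.ae_totalWeight_lt_top t ω).mono fun w hw =>
          laplaceVar_ofPoints hw hg
    _ = expNeg (∑' p : ω.Particle, evolve Pr W t g p.1) :=
        lintegral_expNeg_tsum_infinitePi _ fun p : ω.Particle =>
          (measurable_zeroExt hg).comp (hW.measurable_absorbed_const p.pos t)
    _ = laplaceVar (evolve Pr W t g) ω := by rw [laplaceVar, ω.lintegral_eq_tsum_particle]

end IsRegularBrownian

end FreeLaw

/-! ### Invariance under modification of the driving process -/

section Congr

variable {S : Type*} {W W' : ℝ≥0 → S → ℝ} {s : S}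

lemma absorbed_congr_path (h : ∀ t, W t s = W' t s) (x : ℝ) (t : ℝ≥0) :
    absorbed W x t s = absorbed W' x t s :=
  congrArg (fun w : ℝ≥0 → ℝ => absorbed (fun t (_ : Unit) => w t) x t ()) (funext h)

lemma hitTime_congr_path (h : ∀ t, W t s = W' t s) (x a : ℝ) :
    hitTime W x a s = hitTime W' x a s :=
  congrArg (fun w : ℝ≥0 → ℝ => hitTime (fun t (_ : Unit) => w t) x a ()) (funext h)

variable [MeasurableSpace S] {Pr : Measure S}

lemma freeLaw_congr [IsProbabilityMeasure Pr] (h : ∀ᵐ s ∂Pr, ∀ t, W t s = W' t s) (t : ℝ≥0)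
    (ω : Configuration) : freeLaw Pr W t ω = freeLaw Pr W' t ω := by
  have hall : ∀ᵐ w ∂Measure.infinitePi fun _ : ω.Particle => Pr, ∀ p, ∀ t,
      W t (w p) = W' t (w p) :=
    ae_all_iff.2 fun p => (measurePreserving_eval_infinitePi
      (fun _ : ω.Particle => Pr) p).quasiMeasurePreserving.ae h
  refine Measure.map_congr (hall.mono fun w hw => ?_)
  exact congrArg Configuration.ofPoints (funext fun p => absorbed_congr_path (hw p) _ _)

lemma injection_congr (h : ∀ᵐ s ∂Pr, ∀ t, W t s = W' t s) (lam₀ lam₁ t : ℝ≥0) :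
    injection Pr W lam₀ lam₁ t = injection Pr W' lam₀ lam₁ t := by
  have key (x a : ℝ) : Pr {s | hitTime W x a s ≤ (t : WithTop ℝ≥0)} =
      Pr {s | hitTime W' x a s ≤ (t : WithTop ℝ≥0)} :=
    measure_congr <| eventuallyEq_set.2 <| h.mono fun s hs =>
      iff_of_eq (congrArg (· ≤ (t : WithTop ℝ≥0)) (hitTime_congr_path hs x a))
  simp only [injection, key]

lemma gasLaw_congr [IsProbabilityMeasure Pr] (h : ∀ᵐ s ∂Pr, ∀ t, W t s = W' t s)
    (lam₀ lam₁ : ℝ≥0) : gasLaw Pr W lam₀ lam₁ = gasLaw Pr W' lam₀ lam₁ := by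
  ext t ω : 2
  simp only [gasLaw, injection_congr h, freeLaw_congr h]

end Congr

/-! ### The Laplace functional of the Poisson point process -/

section Poisson

open BrownianGas.Configuration

lemma lintegral_prod_pi {n : ℕ} {E : Fin n → Type*} [∀ i, MeasurableSpace (E i)]
    (μ : ∀ i, Measure (E i)) [∀ i, SigmaFinite (μ i)] {f : ∀ i, E i → ℝ≥0∞}
    (hf : ∀ i, Measurable (f i)) :
    ∫⁻ x, ∏ i, f i (x i) ∂Measure.pi μ = ∏ i, ∫⁻ x, f i x ∂μ i := by
  induction n with
  | zero => simp
  | succ n ih =>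
    have htail : Measurable fun x : ∀ i : Fin n, E i.succ => ∏ i, f i.succ (x i) :=
      Finset.measurable_fun_prod _ fun i _ => (hf _).comp (measurable_pi_apply i)
    have hprod : Measurable fun z : E 0 × (∀ i : Fin n, E i.succ) =>
        f 0 z.1 * ∏ i, f i.succ (z.2 i) :=
      ((hf 0).comp measurable_fst).mul (htail.comp measurable_snd)
    rw [Fin.prod_univ_succ, ← ih _ fun i => hf i.succ,
      ← lintegral_prod_mul (hf 0).aemeasurable htail.aemeasurable]
    refine .trans (lintegral_congr fun x => ?_)
      ((measurePreserving_piFinSuccAbove μ 0).lintegral_comp hprod)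
    exact Fin.prod_univ_succ _

lemma tsum_poisson_mul_pow {r : ℝ} (hr : 0 ≤ r) (a : ℝ) :
    ∑' n : ℕ, ENNReal.ofReal (Real.exp (-a) / n.factorial) * ENNReal.ofReal r ^ n =
      ENNReal.ofReal (Real.exp (-(a - r))) := by
  have h := (NormedSpace.expSeries_div_hasSum_exp r).mul_left (Real.exp (-a))
  rw [← Real.exp_eq_exp_ℝ, ← Real.exp_add, ← sub_eq_neg_add, ← neg_sub] at h
  rw [← h.tsum_eq, ENNReal.ofReal_tsum_of_nonneg (fun n => by positivity) h.summable]
  refine tsum_congr fun n => ?_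
  rw [← ENNReal.ofReal_pow hr, ← ENNReal.ofReal_mul (by positivity), div_mul_eq_mul_div,
    mul_div_assoc]

variable (μ : Measure I01) [IsFiniteMeasure μ] {g : I01 → ℝ≥0∞}

lemma lintegral_laplaceVar_map_ofPoints (hg : Measurable g) (n : ℕ) :
    ∫⁻ η, laplaceVar g η ∂(Measure.pi fun _ : Fin n => μ).map
        (fun x => ofPoints fun i => (x i : ℝ)) = (∫⁻ x, expNeg (g x) ∂μ) ^ n := by
  have hfin (x : Fin n → I01) : totalWeight (fun i => (x i : ℝ)) < ∞ := by
    simp [totalWeight, tsum_fintype, ENNReal.sum_lt_top]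
  calc ∫⁻ η, laplaceVar g η ∂(Measure.pi fun _ : Fin n => μ).map
        (fun x => ofPoints fun i => (x i : ℝ))
      = ∫⁻ x, laplaceVar g (ofPoints fun i => (x i : ℝ)) ∂Measure.pi fun _ : Fin n => μ :=
        lintegral_map (measurable_laplaceVar hg)
          (measurable_ofPoints fun i => measurable_subtype_coe.comp (measurable_pi_apply i))
    _ = ∫⁻ x, ∏ i, expNeg (g (x i)) ∂Measure.pi fun _ : Fin n => μ :=
        lintegral_congr fun x => by
          simp only [laplaceVar_ofPoints (hfin x) hg, zeroExt_coe, tsum_fintype, expNeg_sum]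
    _ = (∫⁻ x, expNeg (g x) ∂μ) ^ n := by
        rw [lintegral_prod_pi (f := fun _ x => expNeg (g x)) _ fun _ => measurable_expNeg.comp hg,
          Finset.prod_const, Finset.card_univ, Fintype.card_fin]

lemma lintegral_laplaceVar_poissonLaw (hg : Measurable g) :
    ∫⁻ η, laplaceVar g η ∂poissonLaw μ = expNeg (∫⁻ x, (1 - expNeg (g x)) ∂μ) := by
  set q := ∫⁻ x, expNeg (g x) ∂μ with hq
  have hexp : Measurable fun x => expNeg (g x) := measurable_expNeg.comp hg
  have hqμ : q ≤ μ Set.univ := (lintegral_mono fun x => expNeg_le_one (g x)).trans (by simp)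
  have hμ_top := measure_ne_top μ Set.univ
  have hq_top : q ≠ ∞ := ne_top_of_le_ne_top hμ_top hqμ
  have hqμ_real : q.toReal ≤ μ.real Set.univ := ENNReal.toReal_mono hμ_top hqμ
  have hsub : ∫⁻ x, (1 - expNeg (g x)) ∂μ = ENNReal.ofReal (μ.real Set.univ - q.toReal) := by
    rw [lintegral_sub hexp hq_top (ae_of_all _ fun x => expNeg_le_one _),
      lintegral_one, ← hq, Measure.real, ← ENNReal.toReal_sub_of_le hqμ hμ_top,
      ENNReal.ofReal_toReal (ENNReal.sub_ne_top hμ_top)]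
  calc ∫⁻ η, laplaceVar g η ∂poissonLaw μ
      = ∑' n : ℕ, ENNReal.ofReal (Real.exp (-μ.real Set.univ) / n.factorial) * q ^ n := by
        simp only [poissonLaw, lintegral_sum_measure, lintegral_smul_measure, smul_eq_mul,
          lintegral_laplaceVar_map_ofPoints μ hg, hq]
    _ = ENNReal.ofReal (Real.exp (-(μ.real Set.univ - q.toReal))) := by
        rw [← tsum_poisson_mul_pow ENNReal.toReal_nonneg, ENNReal.ofReal_toReal hq_top]
    _ = expNeg (∫⁻ x, (1 - expNeg (g x)) ∂μ) := by
        rw [hsub, expNeg_ofReal (sub_nonneg.2 hqμ_real)]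

instance : IsProbabilityMeasure (poissonLaw μ) :=
  ⟨by simpa [laplaceVar] using lintegral_laplaceVar_poissonLaw μ (g := 0) measurable_zero⟩

end Poisson

/-! ### The injection measure -/

/-- The function on `ℝ` with value `λ₀` at `0`, `λ₁` at `1` and `0` elsewhere; its image under the
semigroup of absorbed Brownian motion is the density of the injection measure. -/
noncomputable def boundaryRate (lam₀ lam₁ : ℝ≥0) : ℝ → ℝ≥0∞ :=
  Set.indicator {0} (fun _ => (lam₀ : ℝ≥0∞)) + Set.indicator {1} (fun _ => (lam₁ : ℝ≥0∞))

lemma measurable_boundaryRate (lam₀ lam₁ : ℝ≥0) : Measurable (boundaryRate lam₀ lam₁) :=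
  (measurable_const.indicator (measurableSet_singleton 0)).add
    (measurable_const.indicator (measurableSet_singleton 1))

lemma boundaryRate_of_mem (lam₀ lam₁ : ℝ≥0) {y : ℝ} (hy : y ∈ Set.Ioo (0 : ℝ) 1) :
    boundaryRate lam₀ lam₁ y = 0 := by
  simp [boundaryRate, hy.1.ne', hy.2.ne]

lemma zeroExt_mul_coe (f : I01 → ℝ≥0∞) (F : ℝ → ℝ≥0∞) (y : ℝ) :
    zeroExt (fun x => f x * F x) y = zeroExt f y * F y := by
  by_cases hy : y ∈ Set.Ioo (0 : ℝ) 1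
  · lift y to I01 using hy
    simp only [zeroExt_coe]
  · simp only [zeroExt_of_notMem _ hy, zero_mul]

namespace IsRegularBrownian

variable {S : Type*} [MeasurableSpace S] {Pr : Measure S} {W : ℝ≥0 → S → ℝ}

lemma semigroup_zero (hW : IsRegularBrownian W Pr) (F : ℝ → ℝ≥0∞) :
    semigroup Pr W 0 F = F := by
  have := hW.isProbabilityMeasure
  ext x
  simp [semigroup, absorbed_zero (hW.continuous_path _), hW.zero]

lemma semigroup_of_notMem (hW : IsRegularBrownian W Pr) (t : ℝ≥0) (F : ℝ → ℝ≥0∞) {y : ℝ}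
    (hy : y ∉ Set.Ioo (0 : ℝ) 1) : semigroup Pr W t F y = F y := by
  have := hW.isProbabilityMeasure
  have h0 (s : S) : absorbed W y 0 s = y := by
    rw [absorbed_zero (hW.continuous_path s), hW.zero, add_zero]
  have h (s : S) : absorbed W y t s = y := by
    rw [absorbed_eq_of_notMem (hW.continuous_path s) zero_le (by rwa [h0]), h0]
  simp [semigroup, h]

-- Absorption during `[0, s + t]` happens either before time `s` or, for a path that survives up
-- to time `s`, during the following time interval of length `t`.
lemma semigroup_add_of_eq_zero (hW : IsRegularBrownian W Pr) {F : ℝ → ℝ≥0∞} (hF : Measurable F)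
    (hF0 : ∀ y ∈ Set.Ioo (0 : ℝ) 1, F y = 0) (s t : ℝ≥0) (x : ℝ) :
    semigroup Pr W (s + t) F x =
      semigroup Pr W s F x + semigroup Pr W s (zeroExt fun y => semigroup Pr W t F y) x := by
  have h (y : ℝ) :
      semigroup Pr W t F y = F y + zeroExt (fun z : I01 => semigroup Pr W t F z) y := by
    by_cases hy : y ∈ Set.Ioo (0 : ℝ) 1
    · rw [hF0 y hy, zero_add]
      exact (zeroExt_coe (fun z : I01 => semigroup Pr W t F z) ⟨y, hy⟩).symm
    · rw [hW.semigroup_of_notMem t F hy, zeroExt_of_notMem _ hy, add_zero]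
  rw [hW.semigroup_add hF]
  exact (lintegral_congr fun w => h (absorbed W x s w)).trans
    (lintegral_add_left (hF.comp (hW.measurable_absorbed_const x s)) _)

lemma semigroup_boundaryRate (hW : IsRegularBrownian W Pr) (lam₀ lam₁ t : ℝ≥0) (x : ℝ) :
    semigroup Pr W t (boundaryRate lam₀ lam₁) x =
      lam₀ * Pr {s | hitTime W x 0 s ≤ (t : WithTop ℝ≥0)} +
        lam₁ * Pr {s | hitTime W x 1 s ≤ (t : WithTop ℝ≥0)} := by
  have hhit {a : ℝ} (ha : a ∉ Set.Ioo (0 : ℝ) 1) :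
      {s | hitTime W x a s ≤ (t : WithTop ℝ≥0)} = absorbed W x t ⁻¹' {a} :=
    Set.ext fun s => hitTime_le_iff (hW.continuous_path s) ha t
  have hmeas (a : ℝ) : MeasurableSet (absorbed W x t ⁻¹' {a}) :=
    hW.measurable_absorbed_const x t (measurableSet_singleton a)
  rw [hhit (a := 0) (by simp), hhit (a := 1) (by simp), ← lintegral_indicator_const (hmeas 0),
    ← lintegral_indicator_const (hmeas 1),
    ← lintegral_add_left (measurable_const.indicator (hmeas 0))]
  rfl

variable {f : I01 → ℝ≥0∞}

lemma lintegral_injection (hW : IsRegularBrownian W Pr) (lam₀ lam₁ t : ℝ≥0) (hf : Measurable f) :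
    ∫⁻ x, f x ∂injection Pr W lam₀ lam₁ t =
      ∫⁻ x, zeroExt f x * semigroup Pr W t (boundaryRate lam₀ lam₁) x := by
  have hd : Measurable fun x : I01 => semigroup Pr W t (boundaryRate lam₀ lam₁) x :=
    (hW.measurable_semigroup_right (measurable_boundaryRate lam₀ lam₁) t).comp
      measurable_subtype_coe
  simp_rw [injection, ← hW.semigroup_boundaryRate]
  rw [lintegral_withDensity_eq_lintegral_mul _ hd hf, mul_comm]
  refine (lintegral_comap_eq_lintegral_extend measurableEmbedding_coe _ _).trans ?_
  exact lintegral_congr (zeroExt_mul_coe f _)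

-- The flow property `μ_{s+t} = μ_s + μ_t Q_s`, with `Q` the semigroup of killed Brownian motion.
lemma lintegral_injection_add (hW : IsRegularBrownian W Pr) (lam₀ lam₁ s t : ℝ≥0)
    (hf : Measurable f) :
    ∫⁻ x, f x ∂injection Pr W lam₀ lam₁ (s + t) = (∫⁻ x, f x ∂injection Pr W lam₀ lam₁ s) +
      ∫⁻ x, semigroup Pr W s (zeroExt f) x ∂injection Pr W lam₀ lam₁ t := by
  have hρ := measurable_boundaryRate lam₀ lam₁
  have hfe := measurable_zeroExt hf
  set u : I01 → ℝ≥0∞ := fun y => semigroup Pr W t (boundaryRate lam₀ lam₁) y with hu_def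
  have hu : Measurable u :=
    (hW.measurable_semigroup_right hρ t).comp measurable_subtype_coe
  have hfs : Measurable fun y : I01 => semigroup Pr W s (zeroExt f) y :=
    (hW.measurable_semigroup_right hfe s).comp measurable_subtype_coe
  calc ∫⁻ x, f x ∂injection Pr W lam₀ lam₁ (s + t)
      = ∫⁻ x, (zeroExt f x * semigroup Pr W s (boundaryRate lam₀ lam₁) x +
          zeroExt f x * semigroup Pr W s (zeroExt u) x) := by
        simp_rw [hW.lintegral_injection lam₀ lam₁ (s + t) hf,
          hW.semigroup_add_of_eq_zero hρ (fun _ => boundaryRate_of_mem lam₀ lam₁), mul_add, hu_def]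
    _ = (∫⁻ x, f x ∂injection Pr W lam₀ lam₁ s) +
          ∫⁻ x, zeroExt f x * semigroup Pr W s (zeroExt u) x := by
        rw [hW.lintegral_injection lam₀ lam₁ s hf]
        exact lintegral_add_left (hfe.mul (hW.measurable_semigroup_right hρ s)) _
    _ = (∫⁻ x, f x ∂injection Pr W lam₀ lam₁ s) +
          ∫⁻ x, zeroExt u x * semigroup Pr W s (zeroExt f) x := by
        rw [hW.lintegral_mul_semigroup_comm hf hu]
    _ = (∫⁻ x, f x ∂injection Pr W lam₀ lam₁ s) +
          ∫⁻ x, semigroup Pr W s (zeroExt f) x ∂injection Pr W lam₀ lam₁ t := by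
        simp_rw [hW.lintegral_injection lam₀ lam₁ t hfs, ← zeroExt_mul_coe, hu_def, mul_comm]

end IsRegularBrownian

/-! ### The transition function of the boundary driven gas -/

lemma measurable_one_sub_expNeg {g : I01 → ℝ≥0∞} (hg : Measurable g) :
    Measurable fun x => 1 - expNeg (g x) :=
  measurable_const.sub (measurable_expNeg.comp hg)

namespace IsRegularBrownian

open BrownianGas.Configuration

variable {S : Type*} [MeasurableSpace S] {Pr : Measure S} {W : ℝ≥0 → S → ℝ}

lemma evolve_zero (hW : IsRegularBrownian W Pr) (g : I01 → ℝ≥0∞) : evolve Pr W 0 g = g := by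
  ext x
  rw [evolve, hW.semigroup_zero, zeroExt_coe, negLog_expNeg]

lemma evolve_add (hW : IsRegularBrownian W Pr) (s t : ℝ≥0) {g : I01 → ℝ≥0∞} (hg : Measurable g) :
    evolve Pr W (s + t) g = evolve Pr W s (evolve Pr W t g) := by
  have := hW.isProbabilityMeasure
  have hexp : Measurable fun y => expNeg (zeroExt g y) :=
    measurable_expNeg.comp (measurable_zeroExt hg)
  have h (y : ℝ) : semigroup Pr W t (fun y => expNeg (zeroExt g y)) y =
      expNeg (zeroExt (evolve Pr W t g) y) := by
    by_cases hy : y ∈ Set.Ioo (0 : ℝ) 1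
    · lift y to I01 using hy
      rw [zeroExt_coe, expNeg_evolve]
    · rw [hW.semigroup_of_notMem t _ hy, zeroExt_of_notMem _ hy, zeroExt_of_notMem _ hy]
  ext x
  rw [evolve, hW.semigroup_add hexp, funext h, evolve]

lemma one_sub_expNeg_evolve (hW : IsRegularBrownian W Pr) (t : ℝ≥0) {g : I01 → ℝ≥0∞}
    (hg : Measurable g) (x : I01) :
    1 - expNeg (evolve Pr W t g x) = semigroup Pr W t (zeroExt fun y => 1 - expNeg (g y)) x := by
  have := hW.isProbabilityMeasure
  have hmeas : Measurable fun s => expNeg (zeroExt g (absorbed W x t s)) :=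
    (measurable_expNeg.comp (measurable_zeroExt hg)).comp (hW.measurable_absorbed_const x t)
  have hle : ∫⁻ s, expNeg (zeroExt g (absorbed W x t s)) ∂Pr ≤ 1 :=
    (lintegral_mono fun _ => expNeg_le_one _).trans (by simp)
  have hzero (y : ℝ) : 1 - expNeg (zeroExt g y) = zeroExt (fun y => 1 - expNeg (g y)) y := by
    by_cases hy : y ∈ Set.Ioo (0 : ℝ) 1
    · lift y to I01 using hy
      simp only [zeroExt_coe]
    · simp only [zeroExt_of_notMem _ hy, expNeg_zero, tsub_self]
  calc 1 - expNeg (evolve Pr W t g x)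
      = ∫⁻ _, 1 ∂Pr - ∫⁻ s, expNeg (zeroExt g (absorbed W x t s)) ∂Pr := by
        rw [expNeg_evolve, semigroup, lintegral_one, measure_univ]
    _ = ∫⁻ s, (1 - expNeg (zeroExt g (absorbed W x t s))) ∂Pr :=
        (lintegral_sub hmeas (ne_top_of_le_ne_top ENNReal.one_ne_top hle)
          (ae_of_all _ fun _ => expNeg_le_one _)).symm
    _ = semigroup Pr W t (zeroExt fun y => 1 - expNeg (g y)) x :=
        lintegral_congr fun s => hzero _

variable [IsProbabilityMeasure Pr]

lemma isProbabilityMeasure_gasLaw (hW : IsRegularBrownian W Pr) (lam₀ lam₁ t : ℝ≥0)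
    (ω : Configuration) : IsProbabilityMeasure (gasLaw Pr W lam₀ lam₁ t ω) := by
  have := hW.isProbabilityMeasure_freeLaw t ω
  exact Measure.isProbabilityMeasure_map Configuration.measurable_add.aemeasurable

lemma lintegral_laplaceVar_gasLaw (hW : IsRegularBrownian W Pr) (lam₀ lam₁ t : ℝ≥0)
    (ω : Configuration) {g : I01 → ℝ≥0∞} (hg : Measurable g) :
    ∫⁻ η, laplaceVar g η ∂gasLaw Pr W lam₀ lam₁ t ω =
      expNeg (∫⁻ x, (1 - expNeg (g x)) ∂injection Pr W lam₀ lam₁ t) *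
        laplaceVar (evolve Pr W t g) ω := by
  have := hW.isProbabilityMeasure_freeLaw t ω
  have hlap := measurable_laplaceVar hg
  rw [gasLaw, lintegral_map hlap Configuration.measurable_add]
  simp_rw [laplaceVar_add_configuration]
  rw [lintegral_prod_mul hlap.aemeasurable hlap.aemeasurable, lintegral_laplaceVar_poissonLaw _ hg,
    hW.lintegral_laplaceVar_freeLaw t ω hg]

lemma measurable_gasLaw (hW : IsRegularBrownian W Pr) (lam₀ lam₁ : ℝ≥0) :
    Measurable fun p : ℝ≥0 × Configuration => gasLaw Pr W lam₀ lam₁ p.1 p.2 := by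
  have := fun p : ℝ≥0 × Configuration => hW.isProbabilityMeasure_gasLaw lam₀ lam₁ p.1 p.2
  refine measurable_measure_of_laplace fun g hg => ?_
  have hg' := measurable_one_sub_expNeg hg
  simp_rw [hW.lintegral_laplaceVar_gasLaw lam₀ lam₁ _ _ hg,
    hW.lintegral_injection lam₀ lam₁ _ hg']
  have hpoisson : Measurable fun t : ℝ≥0 => ∫⁻ x, zeroExt (fun x => 1 - expNeg (g x)) x *
      semigroup Pr W t (boundaryRate lam₀ lam₁) x :=
    Measurable.lintegral_prod_right' (f := fun p : ℝ≥0 × ℝ =>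
      zeroExt (fun x => 1 - expNeg (g x)) p.2 * semigroup Pr W p.1 (boundaryRate lam₀ lam₁) p.2)
      (((measurable_zeroExt hg').comp measurable_snd).mul
        (hW.measurable_semigroup (measurable_boundaryRate lam₀ lam₁)))
  have hfree : Measurable fun p : ℝ≥0 × Configuration => laplaceVar (evolve Pr W p.1 g) p.2 :=
    measurable_expNeg.comp (measurable_lintegral_toMeasure
      (f := fun t x => evolve Pr W t g x) (hW.measurable_evolve hg))
  exact (measurable_expNeg.comp (hpoisson.comp measurable_fst)).mul hfree

lemma measurable_gasLaw_right (hW : IsRegularBrownian W Pr) (lam₀ lam₁ t : ℝ≥0) :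
    Measurable (gasLaw Pr W lam₀ lam₁ t) :=
  Measurable.of_uncurry_left (f := gasLaw Pr W lam₀ lam₁) (hW.measurable_gasLaw lam₀ lam₁)

lemma gasLaw_zero (hW : IsRegularBrownian W Pr) (lam₀ lam₁ : ℝ≥0) (ω : Configuration) :
    gasLaw Pr W lam₀ lam₁ 0 ω = Measure.dirac ω := by
  have := hW.isProbabilityMeasure_gasLaw lam₀ lam₁ 0 ω
  refine measure_ext_of_laplace fun g hg => ?_
  have hinj (x : ℝ) : zeroExt (fun x => 1 - expNeg (g x)) x *
      semigroup Pr W 0 (boundaryRate lam₀ lam₁) x = 0 := by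
    by_cases hx : x ∈ Set.Ioo (0 : ℝ) 1
    · rw [hW.semigroup_zero, boundaryRate_of_mem lam₀ lam₁ hx, mul_zero]
    · rw [zeroExt_of_notMem _ hx, zero_mul]
  rw [hW.lintegral_laplaceVar_gasLaw lam₀ lam₁ 0 ω hg, hW.evolve_zero,
    lintegral_dirac' _ (measurable_laplaceVar hg),
    hW.lintegral_injection lam₀ lam₁ 0 (measurable_one_sub_expNeg hg)]
  simp only [hinj, lintegral_zero, expNeg_zero, one_mul]

lemma gasLaw_add (hW : IsRegularBrownian W Pr) (lam₀ lam₁ s t : ℝ≥0) (ω : Configuration) :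
    gasLaw Pr W lam₀ lam₁ (s + t) ω =
      (gasLaw Pr W lam₀ lam₁ s ω).bind (gasLaw Pr W lam₀ lam₁ t) := by
  have hprob := hW.isProbabilityMeasure_gasLaw lam₀ lam₁
  have hmeas := hW.measurable_gasLaw_right lam₀ lam₁ t
  have := hprob s ω
  have := hprob (s + t) ω
  have := isProbabilityMeasure_bind hmeas.aemeasurable
    (ae_of_all (gasLaw Pr W lam₀ lam₁ s ω) (hprob t))
  refine measure_ext_of_laplace fun g hg => ?_
  have hV := hW.measurable_evolve_right hg t
  calc ∫⁻ η, laplaceVar g η ∂gasLaw Pr W lam₀ lam₁ (s + t) ω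
      = expNeg (∫⁻ x, (1 - expNeg (g x)) ∂injection Pr W lam₀ lam₁ (s + t)) *
          laplaceVar (evolve Pr W (s + t) g) ω :=
        hW.lintegral_laplaceVar_gasLaw lam₀ lam₁ (s + t) ω hg
    _ = expNeg (∫⁻ x, (1 - expNeg (g x)) ∂injection Pr W lam₀ lam₁ t) *
          (expNeg (∫⁻ x, (1 - expNeg (evolve Pr W t g x)) ∂injection Pr W lam₀ lam₁ s) *
            laplaceVar (evolve Pr W s (evolve Pr W t g)) ω) := by
        simp_rw [hW.one_sub_expNeg_evolve t hg]
        rw [add_comm s t, hW.lintegral_injection_add lam₀ lam₁ t s (measurable_one_sub_expNeg hg),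
          expNeg_add, mul_assoc, add_comm t s, hW.evolve_add s t hg]
    _ = ∫⁻ η, ∫⁻ ζ, laplaceVar g ζ ∂gasLaw Pr W lam₀ lam₁ t η ∂gasLaw Pr W lam₀ lam₁ s ω := by
        simp_rw [hW.lintegral_laplaceVar_gasLaw lam₀ lam₁ t _ hg]
        rw [lintegral_const_mul _ (measurable_laplaceVar hV),
          hW.lintegral_laplaceVar_gasLaw lam₀ lam₁ s ω hV]
    _ = ∫⁻ η, laplaceVar g η ∂(gasLaw Pr W lam₀ lam₁ s ω).bind (gasLaw Pr W lam₀ lam₁ t) :=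
        (Measure.lintegral_bind hmeas.aemeasurable (measurable_laplaceVar hg).aemeasurable).symm

lemma isTransitionFunction_gasLaw (hW : IsRegularBrownian W Pr) (lam₀ lam₁ : ℝ≥0) :
    IsTransitionFunction (gasLaw Pr W lam₀ lam₁) where
  isProbabilityMeasure := hW.isProbabilityMeasure_gasLaw lam₀ lam₁
  zero := hW.gasLaw_zero lam₀ lam₁
  measurable _ hB := (Measure.measurable_coe hB).comp (hW.measurable_gasLaw lam₀ lam₁)
  chapmanKolmogorov s t ω B hB := by
    rw [hW.gasLaw_add, Measure.bind_apply hB (hW.measurable_gasLaw_right lam₀ lam₁ t).aemeasurable]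

end IsRegularBrownian

end BrownianGas

theorem lemma2p1 {S : Type*} [MeasurableSpace S] (Pr : Measure S) [IsProbabilityMeasure Pr]
    (W : ℝ≥0 → S → ℝ) (hW : IsBrownianReal W Pr) (lam₀ lam₁ : ℝ≥0) :
    BrownianGas.IsTransitionFunction (BrownianGas.gasLaw Pr W lam₀ lam₁) := by
  obtain ⟨W', hW', hae⟩ := BrownianGas.exists_isRegularBrownian hW
  rw [BrownianGas.gasLaw_congr hae]
  exact hW'.isTransitionFunction_gasLaw lam₀ lam₁
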